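/- **Setting.** Let $V\subset\mathbb Z^d$ be finite, $n=|V|$, with a spin $1/2$ on every site (Hilbert space $(\mathbb C^2)^{\otimes V}$), and let $\mathrm{dist}$ be the Manhattan distance. Let $H=\sum_{i\in V}H_i$ and $\Omega=\sum_{i\in V}\Omega_i$ with Hermitian $H_i,\Omega_i$, $\|H_i\|\le1$, $\|\Omega_i\|\le1$ (operator norm), where $H_i$ (resp. $\Omega_i$) acts only on the spins $j$ with $\mathrm{dist}(i,j)\le\ell_0$ (resp. $\le\ell$). Let $|E_m\rangle$, $m=0,\dots,2^n-1$, be any orthonormal basis of eigenvectors of $H$, with eigenvalues $E_m$. For $\Delta>0$ let $\mathcal N_{E,\Delta}$ be the number of $m$ with $E_m\in(E-\Delta,E]$, put $\rho_{E,\Delta}=\mathcal N_{E,\Delta}^{-1}\sum_{E_m\in(E-\Delta,E]}|E_m\rangle\langle E_m|$, $\langle O\rangle_{E,\Delta}=\mathrm{tr}(\rho_{E,\Delta}O)$ and $$\mathrm{Var}_{E,\Delta}(O)=\frac1{\mathcal N_{E,\Delta}}\sum_{E_m\in(E-\Delta,E]}\bigl(\langle E_m|O|E_m\rangle-\langle O\rangle_{E,\Delta}\bigr)^2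 .$$ **Hypotheses.** For an inverse temperature $\beta$, the energy $E$ maximizes $E'\mapsto e^{-\beta E'}\mathcal N_{E',\Delta}$ over $\mathbb R$, and $\rho_\beta=e^{-\beta H}/\mathrm{tr}\,e^{-\beta H}$ is $(r,\xi)$-clustering: for all nonempty $X,Y\subseteq V$ with $\mathrm{dist}(X,Y)=\min_{i\in X,j\in Y}\mathrm{dist}(i,j)\ge r$ and all operators $A,B$ supported on $X,Y$ respectively, $$|\mathrm{tr}(\rho_\beta AB)-\mathrm{tr}(\rho_\beta A)\,\mathrm{tr}(\rho_\beta B)|\le\|A\|\,\|B\|\,e^{-\mathrm{dist}(X,Y)/\xi}.$$ Here $r,\ell_0,\ell$ are nonnegative integers, $r\le\ell$, $\xi>0$. Moreover the width is in the following regime, for a number $K\ge1$: $\sqrt n/\Delta\ge1+1/K$, and $\beta\Delta\le K$ or $\Delta\le K\,n^{1/2-1/K}$. (For $n\ge2$ and $\Delta\le1$ this holds with $K=3$, whatever $\beta$ is.) **Claim.** Put $\mathcal B_1=[\log(\sqrt n/\Delta)]^{(d+1)/2}$ and $\mathcal B_2=[\ell^d\log(\sqrt n/\Delta)]^{1/2}$.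 1. There are constants $c_1'',c_2''>0$ depending only on $d,r,\xi,\ell_0$ and $K$ such that for all $\ell$, $V$ and all systems and shells as above $$\mathrm{Var}_{E,\Delta}(\Omega/n)\le\frac1n\max\bigl(c_1''\mathcal B_1^2,\;c_2''\mathcal B_2^2\bigr).$$ 2. In particular, for widths $\Delta=1/\mathrm{poly}(n)$ the variance is $O((\log n)^{d+1}/n)$: for every $\ell$ and every $p\in\mathbb R$ there is $C>0$, depending only on $d,r,\xi,\ell_0,K,\ell,p$, such that for all systems and shells as above with $n\ge2$ and $\Delta\ge n^{-p}/K$ $$\mathrm{Var}_{E,\Delta}(\Omega/n)\le C\,\frac{(\log n)^{d+1}}{n}.$$ -/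

import Mathlib

open scoped Matrix

noncomputable section

/-- Manhattan distance on the hypercubic lattice `ℤ^d`. -/
def manhattan {d : ℕ} (x y : Fin d → ℤ) : ℕ := ∑ k, (x k - y k).natAbs

/-- Operators on the Hilbert space `(ℂ²)^{⊗ V}` of spins `1/2` sitting on the sites of the finite
region `V ⊆ ℤ^d`, as matrices in the product basis, which is labelled by `V → Fin 2`. -/
abbrev SpinOp {d : ℕ} (V : Finset (Fin d → ℤ)) : Type := Matrix (V → Fin 2) (V → Fin 2) ℂ

/-- The Hilbert space `(ℂ²)^{⊗ V}`. -/
abbrev SpinSpace {d : ℕ} (V : Finset (Fin d → ℤ)) : Type := EuclideanSpace ℂ (V → Fin 2)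

variable {d : ℕ} {V : Finset (Fin d → ℤ)}

/-- The operator norm on `(ℂ²)^{⊗ V}`. -/
def opNorm (A : SpinOp V) : ℝ := ‖Matrix.toEuclideanCLM (𝕜 := ℂ) A‖

/-- `A` acts only on the spins in `X`: it has the form `B ⊗ 1` with `B` an operator on the spins
in `X` and `1` the identity on the other spins. -/
def SupportedOn (X : Finset V) (A : SpinOp V) : Prop :=
  ∃ B : Matrix (X → Fin 2) (X → Fin 2) ℂ, ∀ σ τ : V → Fin 2,
    A σ τ = open Classical in
      if ∀ i, i ∉ X → σ i = τ i then B (fun i => σ i) (fun i => τ i) else 0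

/-- The sites of `V` within Manhattan distance `s` of the site `i`. -/
def siteBall (i : V) (s : ℕ) : Finset V := {j | manhattan (i : Fin d → ℤ) j ≤ s}

/-- `dist(X, Y) = min_{i ∈ X, j ∈ Y} dist(i, j)` (used for nonempty `X`, `Y` only). -/
def setDist (X Y : Finset V) : ℕ :=
  sInf {k | ∃ i ∈ X, ∃ j ∈ Y, manhattan (i : Fin d → ℤ) j = k}

/-- A family of local terms, one for each site: `h i` is Hermitian, has operator norm at most `1`
and acts only on spins within distance `s` of the site `i`. -/
def IsLocalFamily (s : ℕ) (h : V → SpinOp V) : Prop :=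
  ∀ i, (h i).IsHermitian ∧ opNorm (h i) ≤ 1 ∧ SupportedOn (siteBall i s) (h i)

/-- The expectation value `tr(ρ A)`. -/
def expect (ρ A : SpinOp V) : ℂ := (ρ * A).trace

/-- The canonical ensemble `ρ_β = e^{-βH} / tr e^{-βH}`. -/
def gibbs (β : ℝ) (H : SpinOp V) : SpinOp V :=
  (NormedSpace.exp (-(β : ℂ) • H)).trace⁻¹ • NormedSpace.exp (-(β : ℂ) • H)

/-- The `(r, ξ)`-clustering property of a density matrix. -/
def Clustering (r : ℕ) (ξ : ℝ) (ρ : SpinOp V) : Prop :=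
  ∀ (X Y : Finset V), X.Nonempty → Y.Nonempty → r ≤ setDist X Y →
    ∀ A B : SpinOp V, SupportedOn X A → SupportedOn Y B →
      ‖expect ρ (A * B) - expect ρ A * expect ρ B‖
        ≤ opNorm A * opNorm B * Real.exp (-(setDist X Y : ℝ) / ξ)

/-- `ψ` is an orthonormal basis of eigenstates of `H`, with eigenenergies `en`. In the presence of
degeneracy every choice of such a basis is allowed. -/
def IsEigenbasis (H : SpinOp V)
    (ψ : OrthonormalBasis (Fin (2 ^ V.card)) ℂ (SpinSpace V)) (en : Fin (2 ^ V.card) → ℝ) : Prop :=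
  ∀ m, Matrix.toEuclideanLin H (ψ m) = (en m : ℂ) • ψ m

/-- The (indices of the) eigenstates with energy in the shell `(E - Δ, E]`. -/
def shell {N : ℕ} (en : Fin N → ℝ) (E Δ : ℝ) : Finset (Fin N) :=
  open Classical in {m | en m ∈ Set.Ioc (E - Δ) E}

/-- `E` maximizes `E' ↦ e^{-β E'} 𝒩_{E', Δ}`, with `𝒩_{E', Δ}` the number of eigenstates in the
shell `(E' - Δ, E']`. -/
def MaximizesShellWeight {N : ℕ} (en : Fin N → ℝ) (β Δ E : ℝ) : Prop :=
  ∀ E' : ℝ, Real.exp (-β * E') * ((shell en E' Δ).card : ℝ)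
    ≤ Real.exp (-β * E) * ((shell en E Δ).card : ℝ)

/-- The expectation `⟨φ| A |φ⟩` of an observable in a pure state. -/
def pureExpect (φ : SpinSpace V) (A : SpinOp V) : ℝ :=
  (inner ℂ φ (Matrix.toEuclideanLin A φ)).re

/-- The microcanonical ensemble `𝒩⁻¹ ∑ |E_m⟩⟨E_m|`, the sum over the shell `(E - Δ, E]`. -/
def microState (ψ : OrthonormalBasis (Fin (2 ^ V.card)) ℂ (SpinSpace V))
    (en : Fin (2 ^ V.card) → ℝ) (E Δ : ℝ) : SpinOp V :=
  ((shell en E Δ).card : ℂ)⁻¹ •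
    ∑ m ∈ shell en E Δ, Matrix.vecMulVec (ψ m).ofLp (star (ψ m).ofLp)

/-- The variance over the energy shell of the eigenstate expectations of `A`. -/
def shellVar (ψ : OrthonormalBasis (Fin (2 ^ V.card)) ℂ (SpinSpace V))
    (en : Fin (2 ^ V.card) → ℝ) (E Δ : ℝ) (A : SpinOp V) : ℝ :=
  ∑ m ∈ shell en E Δ,
    (pureExpect (ψ m) A - (expect (microState ψ en E Δ) A).re) ^ 2 / ((shell en E Δ).card : ℝ)

/-- `𝓑₁ = [log(√n / Δ)]^{(d+1)/2}`. -/
def boundOne (d n : ℕ) (Δ : ℝ) : ℝ := Real.log (√(n : ℝ) / Δ) ^ (((d : ℝ) + 1) / 2)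

/-- `𝓑₂ = [ℓ^d log(√n / Δ)]^{1/2}`. -/
def boundTwo (d n ℓ : ℕ) (Δ : ℝ) : ℝ :=
  ((ℓ : ℝ) ^ d * Real.log (√(n : ℝ) / Δ)) ^ (1 / 2 : ℝ)

/-- The hypotheses on a spin system on `V` with `n = |V|` sites: `H = ∑ h i` and `Ω = ∑ w i` are
sums of local terms of range `ℓ₀` and `ℓ ≥ r`, `ψ` is an eigenbasis of `H` with energies `en`,
the canonical ensemble at inverse temperature `β` is `(r, ξ)`-clustering, and the energy shell
`(E - Δ, E]` corresponds to `β`. -/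
structure IsShellOfClusteringSystem (r ℓ₀ ℓ : ℕ) (ξ : ℝ) (h w : V → SpinOp V)
    (ψ : OrthonormalBasis (Fin (2 ^ V.card)) ℂ (SpinSpace V)) (en : Fin (2 ^ V.card) → ℝ)
    (β E Δ : ℝ) : Prop where
  range_le : r ≤ ℓ
  ham_local : IsLocalFamily ℓ₀ h
  obs_local : IsLocalFamily ℓ w
  eigenbasis : IsEigenbasis (∑ i, h i) ψ en
  clustering : Clustering r ξ (gibbs β (∑ i, h i))
  width_pos : 0 < Δ
  maximizes : MaximizesShellWeight en β Δ E

/-- The regime of shell widths, with a parameter `K ≥ 1`: `√n / Δ` stays away from `1`, and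
either `β Δ` is bounded or `Δ` is smaller than `√n` by some power of `n`. -/
def AdmissibleWidth (K : ℝ) (n : ℕ) (β Δ : ℝ) : Prop :=
  1 + 1 / K ≤ √(n : ℝ) / Δ ∧ (β * Δ ≤ K ∨ Δ ≤ K * (n : ℝ) ^ (1 / 2 - 1 / K))

end

/-! The shell average is compared with the canonical ensemble, where clustering controls high
moments of `Ω`. Put `x = √n / Δ`, `Z = tr e^{-βH}`, and let `W = e^{-βE} 𝒩_{E,Δ}` be the weight of
the shell.

Moments (`norm_expect_sum_pow_le`). After centering each local term, the `2k`-th power of the sum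
expands into words of `2k` letters. A word with a letter far from all others has exponentially small
expectation, because that letter factors out by clustering and has mean zero. In the remaining words
at most `k` letters determine the others up to a bounded displacement (`exists_dominating_card_le`),
so about `n ^ k` words remain instead of `n ^ (2k)`. Summation over the isolation distance gives the
moment bound `(C k n max(k, ℓ)^d)^k`. By Jensen it also bounds the `2k`-th moment of the diagonal
elements `⟨E_m|Ω|E_m⟩` under Boltzmann weights (`exists_gibbs_moment_le`).

Comparison of ensembles (`partition_le_shell_weight`). Every state of the shell has Boltzmann weight
at least `e^{-βE} / Z`, so shell averages of nonnegative functions are at most `Z / W` times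
canonical ones. By the case `k = 1` for `H`, half of `Z` comes from a window of width of order `√n`,
covered by about `x` shells of width `Δ`. Maximality of `E` bounds the weight of each, so `Z / W` is
at most a power of `x`.

Conclusion (`shellVar_le_of_partition_le`, `exists_shellVar_le_max`). Bounding the variance by the
`k`-th root of a `2k`-th moment costs only `(Z / W)^(1/k)`. For `k = ⌈log x⌉` this factor is
bounded, and what remains is `k max(k, ℓ)^d / n`: the two entries of the maximum correspond to `ℓ ≤
k` and `k ≤ ℓ`. -/

noncomputable section

variable {d : ℕ} {V : Finset (Fin d → ℤ)}

/-! ### Supports of operators -/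

/-- Translation of configurations characterizes the operators acting only on the spins in `X`. -/
theorem supportedOn_iff {X : Finset V} {A : SpinOp V} :
    SupportedOn X A ↔ (∀ σ τ : V → Fin 2, (∃ i, i ∉ X ∧ σ i ≠ τ i) → A σ τ = 0) ∧
      ∀ δ : V → Fin 2, (∀ i ∈ X, δ i = 0) → ∀ σ τ, A (σ + δ) (τ + δ) = A σ τ := by
  classical
  constructor
  · rintro ⟨B, hB⟩
    refine ⟨fun σ τ ⟨i, hi, hne⟩ => ?_, fun δ hδ σ τ => ?_⟩
    · rw [hB, if_neg (fun h => hne (h i hi))]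
    · rw [hB, hB]
      have h1 : (fun i : X => (σ + δ) i) = fun i : X => σ i := by
        funext i; simp [hδ i i.2]
      have h2 : (fun i : X => (τ + δ) i) = fun i : X => τ i := by
        funext i; simp [hδ i i.2]
      rw [h1, h2]
      simp only [Pi.add_apply, add_left_inj]
  · rintro ⟨h0, ht⟩
    refine ⟨fun s t => A (fun i => if hi : i ∈ X then s ⟨i, hi⟩ else 0)
      (fun i => if hi : i ∈ X then t ⟨i, hi⟩ else 0), fun σ τ => ?_⟩
    by_cases h : ∀ i, i ∉ X → σ i = τ i
    · rw [if_pos h]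
      -- Off `X` the two configurations agree; translating by `-σ` there makes both vanish, which is
      -- how `B` was read off.
      rw [← ht (fun i => if i ∈ X then 0 else - σ i) (fun i hi => by simp [hi]) σ τ]
      congr 1
      · funext i
        by_cases hi : i ∈ X <;> simp [hi]
      · funext i
        by_cases hi : i ∈ X
        · simp [hi]
        · simp [hi, h i hi]
    · rw [if_neg h]
      push Not at h
      exact h0 σ τ h

theorem SupportedOn.one (X : Finset V) : SupportedOn X (1 : SpinOp V) := by
  rw [supportedOn_iff]
  refine ⟨fun σ τ ⟨i, _, hne⟩ => Matrix.one_apply_ne (fun h => hne (by rw [h])), ?_⟩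
  intro δ _ σ τ
  simp [Matrix.one_apply]

theorem SupportedOn.mono {X Y : Finset V} (hXY : X ⊆ Y) {A : SpinOp V} (hA : SupportedOn X A) :
    SupportedOn Y A := by
  rw [supportedOn_iff] at hA ⊢
  exact ⟨fun σ τ ⟨i, hi, hne⟩ => hA.1 σ τ ⟨i, fun h => hi (hXY h), hne⟩,
    fun δ hδ => hA.2 δ fun i hi => hδ i (hXY hi)⟩

theorem SupportedOn.sub {X : Finset V} {A B : SpinOp V} (hA : SupportedOn X A)
    (hB : SupportedOn X B) : SupportedOn X (A - B) := by
  rw [supportedOn_iff] at hA hB ⊢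
  refine ⟨fun σ τ h => ?_, fun δ hδ σ τ => ?_⟩
  · rw [Matrix.sub_apply, hA.1 σ τ h, hB.1 σ τ h, sub_zero]
  · rw [Matrix.sub_apply, Matrix.sub_apply, hA.2 δ hδ, hB.2 δ hδ]

theorem SupportedOn.smul {X : Finset V} {A : SpinOp V} (c : ℂ) (hA : SupportedOn X A) :
    SupportedOn X (c • A) := by
  rw [supportedOn_iff] at hA ⊢
  refine ⟨fun σ τ h => ?_, fun δ hδ σ τ => ?_⟩
  · rw [Matrix.smul_apply, hA.1 σ τ h, smul_zero]
  · rw [Matrix.smul_apply, Matrix.smul_apply, hA.2 δ hδ]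

theorem SupportedOn.mul {X : Finset V} {A B : SpinOp V} (hA : SupportedOn X A)
    (hB : SupportedOn X B) : SupportedOn X (A * B) := by
  rw [supportedOn_iff] at hA hB ⊢
  refine ⟨fun σ τ ⟨i, hi, hne⟩ => ?_, fun δ hδ σ τ => ?_⟩
  · rw [Matrix.mul_apply]
    refine Finset.sum_eq_zero fun υ _ => ?_
    by_cases h : σ i = υ i
    · rw [hB.1 υ τ ⟨i, hi, fun h' => hne (h.trans h')⟩, mul_zero]
    · rw [hA.1 σ υ ⟨i, hi, h⟩, zero_mul]
  · rw [Matrix.mul_apply, Matrix.mul_apply]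
    refine (Equiv.sum_comp (Equiv.addRight δ) _).symm.trans (Finset.sum_congr rfl fun υ _ => ?_)
    rw [Equiv.coe_addRight, hA.2 δ hδ, hB.2 δ hδ]

/-- Operators with disjoint supports commute. -/
theorem SupportedOn.commute {X Y : Finset V} {A B : SpinOp V} (hA : SupportedOn X A)
    (hB : SupportedOn Y B) (hXY : Disjoint X Y) : Commute A B := by
  classical
  rw [supportedOn_iff] at hA hB
  have hdis : ∀ i ∈ X, i ∉ Y := fun i hX hY => Finset.disjoint_left.1 hXY hX hY
  ext σ τ
  rw [Matrix.mul_apply, Matrix.mul_apply]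
  -- Each matrix product has a single contributing intermediate configuration: `A` can only change
  -- spins in `X`, and `B` none of them.
  let υ₀ : V → Fin 2 := fun i => if i ∈ X then τ i else σ i
  let υ₁ : V → Fin 2 := fun i => if i ∈ X then σ i else τ i
  rw [Finset.sum_eq_single υ₀, Finset.sum_eq_single υ₁]
  · have h1 : A υ₁ τ = A σ υ₀ := by
      rw [← hA.2 (fun i => if i ∈ X then 0 else τ i - σ i) (fun i hi => by simp [hi]) σ υ₀]
      congr 1
      · funext i; by_cases hi : i ∈ X <;> simp [υ₁, hi]
      · funext i; by_cases hi : i ∈ X <;> simp [υ₀, hi]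
    have h2 : B υ₀ τ = B σ υ₁ := by
      rw [← hB.2 (fun i => if i ∈ X then τ i - σ i else 0)
        (fun i hi => if_neg fun h => hdis i h hi) σ υ₁]
      congr 1
      · funext i; by_cases hi : i ∈ X <;> simp [υ₀, hi]
      · funext i; by_cases hi : i ∈ X <;> simp [υ₁, hi]
    rw [h1, h2, mul_comm]
  · intro υ _ hne
    obtain ⟨i, hi⟩ := Function.ne_iff.1 hne
    by_cases hX : i ∈ X
    · rw [hB.1 σ υ ⟨i, hdis i hX, fun h => hi (by simp [υ₁, hX, h])⟩, zero_mul]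
    · rw [hA.1 υ τ ⟨i, hX, fun h => hi (by simp [υ₁, hX, h])⟩, mul_zero]
  · simp
  · intro υ _ hne
    obtain ⟨i, hi⟩ := Function.ne_iff.1 hne
    by_cases hX : i ∈ X
    · rw [hB.1 υ τ ⟨i, hdis i hX, fun h => hi (by simp [υ₀, hX, h])⟩, mul_zero]
    · rw [hA.1 σ υ ⟨i, hX, fun h => hi (by simp [υ₀, hX, h])⟩, zero_mul]
  · simp

/-! ### The operator norm -/

theorem opNorm_nonneg (A : SpinOp V) : 0 ≤ opNorm A := norm_nonneg _

theorem opNorm_mul_le (A B : SpinOp V) : opNorm (A * B) ≤ opNorm A * opNorm B := by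
  unfold opNorm
  rw [map_mul]
  exact norm_mul_le _ _

theorem opNorm_one_le : opNorm (1 : SpinOp V) ≤ 1 := by
  unfold opNorm
  rw [map_one]
  exact ContinuousLinearMap.norm_id_le

theorem opNorm_sub_smul_one_le (A : SpinOp V) (c : ℂ) : opNorm (A - c • 1) ≤ opNorm A + ‖c‖ := by
  unfold opNorm
  rw [map_sub, map_smul, map_one]
  refine (norm_sub_le _ _).trans (add_le_add_right ?_ _)
  rw [norm_smul]
  exact mul_le_of_le_one_right (norm_nonneg _) ContinuousLinearMap.norm_id_le

theorem norm_inner_toEuclideanLin_le (A : SpinOp V) {φ : SpinSpace V} (hφ : ‖φ‖ = 1) :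
    ‖inner ℂ φ (Matrix.toEuclideanLin A φ)‖ ≤ opNorm A := by
  refine (norm_inner_le_norm _ _).trans ?_
  have h := (Matrix.toEuclideanCLM (𝕜 := ℂ) A).le_opNorm φ
  rw [hφ, mul_one] at h
  rw [hφ, one_mul]
  exact h

theorem list_prod_supportedOn {X : Finset V} (L : List (SpinOp V))
    (hL : ∀ A ∈ L, SupportedOn X A) : SupportedOn X L.prod := by
  induction L with
  | nil => exact SupportedOn.one X
  | cons A L ih =>
    rw [List.prod_cons]
    exact (hL A (by simp)).mul (ih fun B hB => hL B (by simp [hB]))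

theorem opNorm_list_prod_le {c : ℝ} (L : List (SpinOp V)) (hL : ∀ A ∈ L, opNorm A ≤ c) :
    opNorm L.prod ≤ c ^ L.length := by
  induction L with
  | nil => simpa using opNorm_one_le
  | cons A L ih =>
    rw [List.prod_cons, List.length_cons, pow_succ']
    have hA := hL A (by simp)
    exact (opNorm_mul_le _ _).trans (mul_le_mul hA (ih fun B hB => hL B (by simp [hB]))
      (opNorm_nonneg _) ((opNorm_nonneg A).trans hA))

/-! ### Words -/

theorem sum_pow_eq_sum_words {ι R : Type*} [Fintype ι] [Ring R] (a : ι → R) (n : ℕ) :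
    (∑ i, a i) ^ n = ∑ f : Fin n → ι, (List.ofFn fun p => a (f p)).prod := by
  induction n with
  | zero => simp
  | succ n ih =>
    rw [pow_succ', ih, Finset.sum_mul_sum, ← Finset.sum_product',
      ← (Fin.consEquiv fun _ : Fin (n + 1) => ι).sum_comp]
    refine Finset.sum_congr rfl fun x _ => ?_
    rw [List.ofFn_succ, List.prod_cons]
    simp [Fin.consEquiv]

/-- A letter that commutes with all other letters of a word can be moved to the front. -/
theorem prod_ofFn_eq_mul_of_commute {R : Type*} [Monoid R] {n : ℕ} (f : Fin n → R) (p : Fin n)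
    (h : ∀ q, q ≠ p → Commute (f p) (f q)) :
    (List.ofFn f).prod = f p * (List.ofFn fun q => if q = p then 1 else f q).prod := by
  induction n with
  | zero => exact p.elim0
  | succ n ih =>
    rw [List.ofFn_succ, List.ofFn_succ, List.prod_cons, List.prod_cons]
    rcases Fin.eq_zero_or_eq_succ p with rfl | ⟨p, rfl⟩
    · simp [Fin.succ_ne_zero]
    · rw [ih (fun q => f q.succ) p fun q hq => h q.succ fun h' => hq (Fin.succ_injective _ h')]
      rw [if_neg (Fin.succ_ne_zero p).symm, ← mul_assoc, ← mul_assoc,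
        (h 0 (Fin.succ_ne_zero p).symm).eq]
      simp [Fin.succ_inj]

/-! ### Spectral form of expectation values -/

theorem trace_eq_sum_inner_basis {ι : Type*} [Fintype ι] (ψ : OrthonormalBasis ι ℂ (SpinSpace V))
    (A : SpinOp V) : A.trace = ∑ m, inner ℂ (ψ m) (Matrix.toEuclideanLin A (ψ m)) := by
  rw [← LinearMap.trace_eq_sum_inner, Matrix.toEuclideanLin_eq_toLin_orthonormal,
    Matrix.trace_toLin_eq]

theorem toEuclideanLin_mul_apply (A B : SpinOp V) (φ : SpinSpace V) :
    Matrix.toEuclideanLin (A * B) φ = Matrix.toEuclideanLin A (Matrix.toEuclideanLin B φ) := by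
  simp [Matrix.toLpLin_apply, Matrix.mulVec_mulVec]

theorem toEuclideanLin_one_apply (φ : SpinSpace V) :
    Matrix.toEuclideanLin (1 : SpinOp V) φ = φ := by
  simp

theorem inner_toEuclideanLin_comm {A : SpinOp V} (hA : A.IsHermitian) (φ χ : SpinSpace V) :
    inner ℂ (Matrix.toEuclideanLin A φ) χ = inner ℂ φ (Matrix.toEuclideanLin A χ) := by
  rw [← LinearMap.adjoint_inner_right, ← Matrix.toEuclideanLin_conjTranspose_eq_adjoint, hA.eq]

/-- Evaluation at `φ` is linear on a finite-dimensional space, hence continuous, so it passes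
through the exponential series. The norm on matrices only serves convergence. -/
theorem toEuclideanLin_exp_apply {A : SpinOp V} {φ : SpinSpace V} {c : ℂ}
    (h : Matrix.toEuclideanLin A φ = c • φ) :
    Matrix.toEuclideanLin (NormedSpace.exp A) φ = NormedSpace.exp c • φ := by
  let _ : NormedRing (SpinOp V) := Matrix.linftyOpNormedRing
  let _ : NormedAlgebra ℂ (SpinOp V) := Matrix.linftyOpNormedAlgebra
  have hpow : ∀ n : ℕ, Matrix.toEuclideanLin (A ^ n) φ = c ^ n • φ := by
    intro n
    induction n with
    | zero => simp
    | succ n ih => rw [pow_succ, toEuclideanLin_mul_apply, h, map_smul, ih, smul_smul, pow_succ']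
  have h1 := NormedSpace.exp_series_hasSum_exp' (𝕂 := ℂ) A
  let ev : SpinOp V →ₗ[ℂ] SpinSpace V :=
    (LinearMap.applyₗ φ).comp (Matrix.toEuclideanLin (𝕜 := ℂ)).toLinearMap
  have h2 := h1.map ev ev.continuous_of_finiteDimensional
  have h3 := (NormedSpace.exp_series_hasSum_exp' (𝕂 := ℂ) c).smul_const φ
  refine h2.unique ?_
  convert h3 using 1
  funext n
  change Matrix.toEuclideanLin _ φ = _
  rw [map_smul, LinearMap.smul_apply, hpow, smul_smul, smul_eq_mul]

/-! ### Lattice geometry -/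

theorem manhattan_self (x : Fin d → ℤ) : manhattan x x = 0 := by simp [manhattan]

theorem manhattan_comm (x y : Fin d → ℤ) : manhattan x y = manhattan y x := by
  unfold manhattan
  exact Finset.sum_congr rfl fun k _ => by omega

theorem manhattan_triangle (x y z : Fin d → ℤ) :
    manhattan x z ≤ manhattan x y + manhattan y z := by
  unfold manhattan
  rw [← Finset.sum_add_distrib]
  exact Finset.sum_le_sum fun k _ => by omega

theorem mem_siteBall {i j : V} {s : ℕ} :
    j ∈ siteBall i s ↔ manhattan (i : Fin d → ℤ) j ≤ s := by
  simp [siteBall]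

theorem self_mem_siteBall (i : V) (s : ℕ) : i ∈ siteBall i s := by
  rw [mem_siteBall, manhattan_self]
  exact Nat.zero_le _

theorem card_siteBall_le (i : V) (s : ℕ) : (siteBall i s).card ≤ (2 * s + 1) ^ d := by
  have h1 : ((siteBall i s).image fun j : V => (j : Fin d → ℤ)) ⊆
      Fintype.piFinset fun k => Finset.Icc ((i : Fin d → ℤ) k - s) ((i : Fin d → ℤ) k + s) := by
    intro x hx
    obtain ⟨j, hj, rfl⟩ := Finset.mem_image.1 hx
    rw [mem_siteBall] at hj
    rw [Fintype.mem_piFinset]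
    intro k
    have : (((i : Fin d → ℤ) k) - (j : Fin d → ℤ) k).natAbs ≤ s :=
      (Finset.single_le_sum (f := fun k => ((i : Fin d → ℤ) k - (j : Fin d → ℤ) k).natAbs)
        (fun _ _ => Nat.zero_le _) (Finset.mem_univ k)).trans hj
    rw [Finset.mem_Icc]
    omega
  rw [← Finset.card_image_of_injective _ Subtype.val_injective]
  refine (Finset.card_le_card h1).trans ?_
  rw [Fintype.card_piFinset]
  refine (Finset.prod_le_prod' (g := fun _ => 2 * s + 1) fun k _ => ?_).trans (by simp)
  rw [Int.card_Icc]
  omega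

theorem le_setDist {X Y : Finset V} (hX : X.Nonempty) (hY : Y.Nonempty) {m : ℕ}
    (h : ∀ i ∈ X, ∀ j ∈ Y, m ≤ manhattan (i : Fin d → ℤ) j) : m ≤ setDist X Y := by
  unfold setDist
  obtain ⟨i, hi⟩ := hX
  obtain ⟨j, hj⟩ := hY
  refine le_csInf ⟨_, i, hi, j, hj, rfl⟩ ?_
  rintro k ⟨i, hi, j, hj, rfl⟩
  exact h i hi j hj

/-! ### Counting words without isolated letters -/

/-- In a finite graph without isolated vertices some set of at most half of the vertices
dominates all other vertices. -/
theorem exists_dominating_card_le {α : Type*} [Fintype α] [DecidableEq α] {k : ℕ}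
    (hcard : Fintype.card α = 2 * k) (R : α → α → Prop) (hsymm : ∀ p q, R p q → R q p)
    (hiso : ∀ p, ∃ q, q ≠ p ∧ R p q) :
    ∃ D : Finset α, D.card ≤ k ∧ ∀ p, p ∉ D → ∃ q ∈ D, R p q := by
  classical
  let S : Finset (Finset α) :=
    Finset.univ.filter fun I => ∀ p ∈ I, ∀ q ∈ I, p ≠ q → ¬ R p q
  -- A maximum independent set dominates by maximality. Its complement also dominates, since the
  -- neighbour of an independent vertex lies outside the set. One of the two has at most `k`
  -- elements.
  obtain ⟨I, hI, hmax⟩ := S.exists_max_image Finset.card ⟨∅, by simp [S]⟩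
  have hind : ∀ p ∈ I, ∀ q ∈ I, p ≠ q → ¬ R p q := (Finset.mem_filter.1 hI).2
  by_cases hk : I.card ≤ k
  · refine ⟨I, hk, fun p hp => ?_⟩
    by_contra! hcon
    have hmem : insert p I ∈ S := by
      refine Finset.mem_filter.2 ⟨Finset.mem_univ _, fun a ha b hb hab => ?_⟩
      rcases Finset.mem_insert.1 ha with rfl | ha'
      · rcases Finset.mem_insert.1 hb with rfl | hb'
        · exact absurd rfl hab
        · exact hcon b hb'
      · rcases Finset.mem_insert.1 hb with rfl | hb'
        · exact fun h => hcon a ha' (hsymm _ _ h)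
        · exact hind a ha' b hb' hab
    have := hmax _ hmem
    rw [Finset.card_insert_of_notMem hp] at this
    omega
  · refine ⟨Iᶜ, by rw [Finset.card_compl]; omega, fun p hp => ?_⟩
    have hpI : p ∈ I := by simpa using hp
    obtain ⟨q, hqp, hR⟩ := hiso p
    exact ⟨q, Finset.mem_compl.2 fun hq => hind p hpI q hq hqp.symm hR, hR⟩

/-- The words of `n` sites in which every letter has another letter within distance `R`. -/
def crowdedWords (V : Finset (Fin d → ℤ)) (n R : ℕ) : Finset (Fin n → V) :=
  open Classical in
  {f | ∀ p, ∃ q, q ≠ p ∧ manhattan (f p : Fin d → ℤ) (f q) ≤ R}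

/-- The letters at positions in `D` are free; each other letter lies in one of `D.card` balls around
them. -/
theorem card_dominated_words_le (n R : ℕ) (D : Finset (Fin n)) :
    ((Finset.univ.filter fun f : Fin n → V =>
      ∀ p, p ∉ D → ∃ q ∈ D, manhattan (f p : Fin d → ℤ) (f q) ≤ R).card) ≤
      (D.card * (2 * R + 1) ^ d) ^ (n - D.card) * V.card ^ D.card := by
  classical
  set S := Finset.univ.filter fun f : Fin n → V =>
      ∀ p, p ∉ D → ∃ q ∈ D, manhattan (f p : Fin d → ℤ) (f q) ≤ R with hS
  refine (Finset.card_le_mul_card_image (f := fun (f : Fin n → V) (p : D) => f p) S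
    ((D.card * (2 * R + 1) ^ d) ^ (n - D.card)) ?_).trans ?_
  · intro u hu
    obtain ⟨g, hg, rfl⟩ := Finset.mem_image.1 hu
    have hsub : (S.filter fun f => (fun p : D => f p) = fun p : D => g p) ⊆
        Fintype.piFinset fun p => if p ∈ D then {g p} else D.biUnion fun q => siteBall (g q) R := by
      intro f hf
      obtain ⟨hfS, hfg⟩ := Finset.mem_filter.1 hf
      have hfg' : ∀ p ∈ D, f p = g p := fun p hp => congrFun hfg ⟨p, hp⟩
      rw [Fintype.mem_piFinset]
      intro p
      by_cases hp : p ∈ D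
      · simp [hp, hfg' p hp]
      · rw [if_neg hp, Finset.mem_biUnion]
        obtain ⟨q, hq, hd⟩ := (Finset.mem_filter.1 hfS).2 p hp
        exact ⟨q, hq, by rw [mem_siteBall, ← hfg' q hq, manhattan_comm]; exact hd⟩
    refine (Finset.card_le_card hsub).trans ?_
    rw [Fintype.card_piFinset]
    calc ∏ p, (if p ∈ D then {g p} else D.biUnion fun q => siteBall (g q) R).card
        ≤ ∏ p, (if p ∈ D then 1 else D.card * (2 * R + 1) ^ d) := by
          refine Finset.prod_le_prod' fun p _ => ?_
          split_ifs
          · simp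
          · exact Finset.card_biUnion_le_card_mul _ _ _ fun q _ => card_siteBall_le _ _
      _ = (D.card * (2 * R + 1) ^ d) ^ (n - D.card) := by
          rw [Finset.prod_ite, Finset.prod_const_one, one_mul, Finset.prod_const,
            Finset.filter_not, Finset.card_sdiff_of_subset (Finset.filter_subset _ _)]
          simp
  · refine Nat.mul_le_mul_left _ ((Finset.card_le_univ _).trans ?_)
    simp

/-- A union bound over the at most `4 ^ k` possible dominating sets. If `V.card ≤ k * B`, counting
all words suffices; otherwise a free letter has more choices than a dominated one, so `D.card = k`
is the worst case. -/
theorem card_crowdedWords_le (V : Finset (Fin d → ℤ)) (k R : ℕ) :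
    (crowdedWords V (2 * k) R).card ≤ 4 ^ k * (k * V.card * (2 * R + 1) ^ d) ^ k := by
  classical
  set B := (2 * R + 1) ^ d with hB
  by_cases hkB : V.card ≤ k * B
  · calc (crowdedWords V (2 * k) R).card ≤ Fintype.card (Fin (2 * k) → V) := Finset.card_le_univ _
      _ = (V.card * V.card) ^ k := by simp [pow_mul, pow_two]
      _ ≤ (k * V.card * B) ^ k := by
          refine Nat.pow_le_pow_left ?_ k
          calc V.card * V.card ≤ k * B * V.card := Nat.mul_le_mul_right _ hkB
            _ = k * V.card * B := by ring
      _ ≤ _ := Nat.le_mul_of_pos_left _ (by positivity)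
  · push Not at hkB
    have hsub : crowdedWords V (2 * k) R ⊆
        (Finset.univ.filter fun D : Finset (Fin (2 * k)) => D.card ≤ k).biUnion fun D =>
          Finset.univ.filter fun f : Fin (2 * k) → V =>
            ∀ p, p ∉ D → ∃ q ∈ D, manhattan (f p : Fin d → ℤ) (f q) ≤ R := by
      intro f hf
      have hf' := (Finset.mem_filter.1 hf).2
      obtain ⟨D, hD, hdom⟩ := exists_dominating_card_le (k := k) (by simp)
        (fun p q => manhattan (f p : Fin d → ℤ) (f q) ≤ R)
        (fun p q h => by rw [manhattan_comm]; exact h) hf'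
      exact Finset.mem_biUnion.2 ⟨D, by simp [hD], by simpa using hdom⟩
    refine (Finset.card_le_card hsub).trans ?_
    refine (Finset.card_biUnion_le_card_mul _ _ ((k * V.card * B) ^ k) fun D hD => ?_).trans ?_
    · have hDk : D.card ≤ k := (Finset.mem_filter.1 hD).2
      refine (card_dominated_words_le (2 * k) R D).trans ?_
      obtain ⟨e, he⟩ := Nat.exists_eq_add_of_le hDk
      calc (D.card * B) ^ (2 * k - D.card) * V.card ^ D.card
          ≤ (k * B) ^ (2 * k - D.card) * V.card ^ D.card := by gcongr
        _ = (k * B) ^ k * ((k * B) ^ e * V.card ^ D.card) := by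
            rw [← mul_assoc, ← pow_add]; congr 2; omega
        _ ≤ (k * B) ^ k * (V.card ^ e * V.card ^ D.card) := by gcongr
        _ = (k * V.card * B) ^ k := by
            rw [← pow_add, add_comm e, ← he, ← mul_pow]; congr 1; ring
    · refine Nat.mul_le_mul_right _ ((Finset.card_le_univ _).trans ?_)
      simp [pow_mul]

/-! ### Moments of sums of local operators in a clustering state -/

theorem expect_sum {ι : Type*} (s : Finset ι) (ρ : SpinOp V) (A : ι → SpinOp V) :
    expect ρ (∑ i ∈ s, A i) = ∑ i ∈ s, expect ρ (A i) := by
  unfold expect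
  rw [Finset.mul_sum, Matrix.trace_sum]

theorem expect_sub (ρ A B : SpinOp V) : expect ρ (A - B) = expect ρ A - expect ρ B := by
  unfold expect
  rw [mul_sub, Matrix.trace_sub]

theorem expect_smul (ρ A : SpinOp V) (c : ℂ) : expect ρ (c • A) = c * expect ρ A := by
  unfold expect
  rw [Matrix.mul_smul, Matrix.trace_smul, smul_eq_mul]

/-- A word of centered local operators with a letter at distance more than `R` from all other
letters has a small expectation in a clustering state. -/
theorem norm_expect_word_le_of_isolated {r ℓ : ℕ} {ξ : ℝ} (hξ : 0 < ξ) {ρ : SpinOp V}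
    (hcl : Clustering r ξ ρ) {a : V → SpinOp V} (ha : ∀ i, opNorm (a i) ≤ 2)
    (hs : ∀ i, SupportedOn (siteBall i ℓ) (a i)) (h0 : ∀ i, expect ρ (a i) = 0) {n R t : ℕ}
    (hn : 2 ≤ n) (hr : r ≤ t) (hR : 2 * ℓ + t ≤ R + 1) (ht : 1 ≤ t) {f : Fin n → V}
    (hf : f ∉ crowdedWords V n R) :
    ‖expect ρ (List.ofFn fun p => a (f p)).prod‖ ≤ 2 ^ (n + 1) * Real.exp (-(t : ℝ) / ξ) := by
  classical
  have hf' : ∃ p, ∀ q, q ≠ p → R < manhattan (f p : Fin d → ℤ) (f q) := by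
    by_contra! hcon
    exact hf (by simpa [crowdedWords] using hcon)
  obtain ⟨p, hp⟩ := hf'
  let Y : Finset V := (Finset.univ.erase p).biUnion fun q => siteBall (f q) ℓ
  have hfar : ∀ q, q ≠ p → ∀ i ∈ siteBall (f p) ℓ, ∀ j ∈ siteBall (f q) ℓ,
      t ≤ manhattan (i : Fin d → ℤ) j := by
    intro q hq i hi j hj
    rw [mem_siteBall] at hi hj
    have h1 := hp q hq
    have h2 := manhattan_triangle (f p : Fin d → ℤ) i (f q)
    have h3 := manhattan_triangle (i : Fin d → ℤ) j (f q)
    rw [manhattan_comm] at hj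
    omega
  have hYne : Y.Nonempty := by
    have : Nontrivial (Fin n) := Fin.nontrivial_iff_two_le.2 hn
    obtain ⟨q, hq⟩ := exists_ne p
    exact ⟨f q, Finset.mem_biUnion.2 ⟨q, by simp [hq], self_mem_siteBall _ _⟩⟩
  have hXne : (siteBall (f p) ℓ).Nonempty := ⟨f p, self_mem_siteBall _ _⟩
  -- Since `t ≥ 1`, the support of the isolated letter is disjoint from the other supports.
  have hcomm : ∀ q, q ≠ p → Commute (a (f p)) (a (f q)) := by
    intro q hq
    refine (hs _).commute (hs _) (Finset.disjoint_left.2 fun i hi hi' => ?_)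
    have := hfar q hq i hi i hi'
    rw [manhattan_self] at this
    omega
  rw [prod_ofFn_eq_mul_of_commute (fun q => a (f q)) p hcomm]
  set W := (List.ofFn fun q => if q = p then 1 else a (f q)).prod with hW
  have hWs : SupportedOn Y W := by
    refine list_prod_supportedOn _ fun A hA => ?_
    obtain ⟨q, rfl⟩ := List.mem_ofFn.1 hA
    by_cases hq : q = p
    · simpa [hq] using SupportedOn.one Y
    · simp only [hq, if_false]
      exact (hs (f q)).mono (Finset.subset_biUnion_of_mem (fun q => siteBall (f q) ℓ)
        (Finset.mem_erase.2 ⟨hq, Finset.mem_univ q⟩))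
  have hWn : opNorm W ≤ 2 ^ n := by
    refine (opNorm_list_prod_le (c := 2) _ fun A hA => ?_).trans (by simp)
    obtain ⟨q, rfl⟩ := List.mem_ofFn.1 hA
    by_cases hq : q = p
    · simpa [hq] using opNorm_one_le.trans (by norm_num)
    · simpa [hq] using ha (f q)
  have hdist : t ≤ setDist (siteBall (f p) ℓ) Y := by
    refine le_setDist hXne hYne fun i hi j hj => ?_
    obtain ⟨q, hq, hj⟩ := Finset.mem_biUnion.1 hj
    exact hfar q (Finset.ne_of_mem_erase hq) i hi j hj
  have hmain := hcl _ _ hXne hYne (hr.trans hdist) _ _ (hs (f p)) hWs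
  rw [h0, zero_mul, sub_zero] at hmain
  refine hmain.trans ?_
  rw [pow_succ']
  have hexp : Real.exp (-(setDist (siteBall (f p) ℓ) Y : ℝ) / ξ) ≤ Real.exp (-(t : ℝ) / ξ) := by
    have : (t : ℝ) ≤ setDist (siteBall (f p) ℓ) Y := by exact_mod_cast hdist
    gcongr
  have := opNorm_nonneg W
  gcongr
  exact ha _

/-- Summing the bounds on words over the distance at which they become crowded. -/
theorem norm_expect_sum_pow_le_sum {r ℓ : ℕ} {ξ : ℝ} (hξ : 0 < ξ) {ρ : SpinOp V}
    (hρ : ∀ A, ‖expect ρ A‖ ≤ opNorm A)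
    (hcl : Clustering r ξ ρ) {a : V → SpinOp V} (ha : ∀ i, opNorm (a i) ≤ 2)
    (hs : ∀ i, SupportedOn (siteBall i ℓ) (a i)) (h0 : ∀ i, expect ρ (a i) = 0) {n : ℕ}
    (hn : 2 ≤ n) :
    ∃ S : ℕ, ‖expect ρ ((∑ i, a i) ^ n)‖ ≤ ∑ s ∈ Finset.range S,
      2 ^ (n + 1) * Real.exp (-(s : ℝ) / ξ) * (crowdedWords V n (2 * ℓ + r + s)).card := by
  classical
  -- A crude bound on the diameter of `V`: at this distance every word is crowded.
  let S : ℕ := ∑ i : V, ∑ j : V, manhattan (i : Fin d → ℤ) j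
  have hall : ∀ f : Fin n → V, f ∈ crowdedWords V n (2 * ℓ + r + S) := by
    intro f
    refine Finset.mem_filter.2 ⟨Finset.mem_univ _, fun p => ?_⟩
    have : Nontrivial (Fin n) := Fin.nontrivial_iff_two_le.2 hn
    obtain ⟨q, hq⟩ := exists_ne p
    refine ⟨q, hq, le_trans ?_ (Nat.le_add_left S _)⟩
    exact (Finset.single_le_sum (f := fun j : V => manhattan (f p : Fin d → ℤ) j)
      (fun _ _ => Nat.zero_le _) (Finset.mem_univ (f q))).trans
      (Finset.single_le_sum (f := fun i : V => ∑ j : V, manhattan (i : Fin d → ℤ) j)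
      (fun _ _ => Nat.zero_le _) (Finset.mem_univ (f p)))
  have hword : ∀ f : Fin n → V, ‖expect ρ (List.ofFn fun p => a (f p)).prod‖ ≤
      ∑ s ∈ Finset.range (S + 1), 2 ^ (n + 1) * Real.exp (-(s : ℝ) / ξ) *
        (if f ∈ crowdedWords V n (2 * ℓ + r + s) then 1 else 0) := by
    intro f
    have hex : ∃ s, f ∈ crowdedWords V n (2 * ℓ + r + s) := ⟨S, hall f⟩
    obtain ⟨s, hsf, hmin⟩ : ∃ s, f ∈ crowdedWords V n (2 * ℓ + r + s) ∧
        ∀ s' < s, f ∉ crowdedWords V n (2 * ℓ + r + s') :=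
      ⟨Nat.find hex, Nat.find_spec hex, fun s' h => Nat.find_min hex h⟩
    have hsS : s ≤ S := by
      by_contra! hcon
      exact hmin S hcon (hall f)
    have hterm : ‖expect ρ (List.ofFn fun p => a (f p)).prod‖ ≤
        2 ^ (n + 1) * Real.exp (-(s : ℝ) / ξ) := by
      rcases Nat.eq_zero_or_pos s with rfl | hpos
      · have h2 : opNorm (List.ofFn fun p => a (f p)).prod ≤ 2 ^ n := by
          refine (opNorm_list_prod_le (c := 2) _ fun A hA => ?_).trans (by simp)
          obtain ⟨q, rfl⟩ := List.mem_ofFn.1 hA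
          exact ha _
        refine (hρ _).trans (h2.trans ?_)
        simp only [Nat.cast_zero, neg_zero, zero_div, Real.exp_zero, mul_one]
        exact pow_le_pow_right₀ (by norm_num) (Nat.le_succ n)
      -- By minimality of `s` some letter is at distance at least `2ℓ + r + s` from the others.
      -- Removing two radii `ℓ` leaves support distance `r + s`, which is at least `r` as clustering
      -- requires.
      · refine (norm_expect_word_le_of_isolated hξ hcl ha hs h0 hn (t := r + s)
          (R := 2 * ℓ + r + (s - 1)) (by omega) (by omega) (by omega)
          (hmin _ (by omega))).trans ?_
        have : (s : ℝ) ≤ ((r + s : ℕ) : ℝ) := by exact_mod_cast Nat.le_add_left s r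
        gcongr
    refine hterm.trans ?_
    refine le_trans (by rw [if_pos hsf, mul_one]) (Finset.single_le_sum
      (f := fun s : ℕ => 2 ^ (n + 1) * Real.exp (-(s : ℝ) / ξ) *
        (if f ∈ crowdedWords V n (2 * ℓ + r + s) then (1 : ℝ) else 0)) (fun s _ => ?_)
      (Finset.mem_range.2 (Nat.lt_succ_of_le hsS)))
    split_ifs <;> positivity
  refine ⟨S + 1, ?_⟩
  rw [sum_pow_eq_sum_words, expect_sum]
  refine (norm_sum_le _ _).trans ((Finset.sum_le_sum fun f _ => hword f).trans ?_)
  rw [Finset.sum_comm]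
  refine Finset.sum_le_sum fun s _ => ?_
  rw [← Finset.mul_sum, Finset.sum_boole]
  simp

theorem sum_exp_neg_div_le {ξ : ℝ} (hξ : 0 < ξ) (S : ℕ) :
    ∑ s ∈ Finset.range S, Real.exp (-(s : ℝ) / ξ) ≤ (1 - Real.exp (-1 / ξ))⁻¹ := by
  have h1 : Real.exp (-1 / ξ) < 1 := by
    rw [Real.exp_lt_one_iff]
    exact div_neg_of_neg_of_pos (by norm_num) hξ
  have h2 := (hasSum_geometric_of_lt_one (Real.exp_pos (-1 / ξ)).le h1)
  refine le_trans (le_of_eq (Finset.sum_congr rfl fun s _ => ?_))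
    (h2.summable.sum_le_tsum (Finset.range S) fun s _ => by positivity) |>.trans_eq h2.tsum_eq
  rw [← Real.exp_nat_mul]
  congr 1
  ring

/-- The constant in the moment bound. -/
def momentConst (d r : ℕ) (ξ : ℝ) : ℝ :=
  32 * Real.exp d * (1 - Real.exp (-1 / (2 * ξ)))⁻¹ * (4 * ξ * d + 2 * r + 5) ^ d

theorem one_le_geometric_bound {ξ : ℝ} (hξ : 0 < ξ) : 1 ≤ (1 - Real.exp (-1 / ξ))⁻¹ := by
  simpa using sum_exp_neg_div_le hξ 1

theorem momentConst_pos (d r : ℕ) {ξ : ℝ} (hξ : 0 < ξ) : 0 < momentConst d r ξ := by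
  have := one_le_geometric_bound (ξ := 2 * ξ) (by positivity)
  unfold momentConst
  positivity

/-- Moments of a centered sum of local terms in a clustering state. -/
theorem norm_expect_sum_pow_le {r ℓ : ℕ} {ξ : ℝ} (hξ : 0 < ξ) {ρ : SpinOp V}
    (hρ : ∀ A, ‖expect ρ A‖ ≤ opNorm A)
    (hcl : Clustering r ξ ρ) {a : V → SpinOp V} (ha : ∀ i, opNorm (a i) ≤ 2)
    (hs : ∀ i, SupportedOn (siteBall i ℓ) (a i)) (h0 : ∀ i, expect ρ (a i) = 0) {k : ℕ}
    (hk : 1 ≤ k) :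
    ‖expect ρ ((∑ i, a i) ^ (2 * k))‖ ≤
      (momentConst d r ξ * (k * V.card * (max k ℓ : ℕ) ^ d)) ^ k := by
  obtain ⟨S, hS⟩ := norm_expect_sum_pow_le_sum hξ hρ hcl ha hs h0 (n := 2 * k) (by omega)
  refine hS.trans ?_
  set M : ℝ := ((max k ℓ : ℕ) : ℝ) with hM
  set G := (1 - Real.exp (-1 / (2 * ξ)))⁻¹ with hG
  have hG1 : 1 ≤ G := one_le_geometric_bound (by positivity)
  have hkM : (k : ℝ) ≤ M := by rw [hM]; exact_mod_cast le_max_left _ _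
  have hlM : (ℓ : ℝ) ≤ M := by rw [hM]; exact_mod_cast le_max_right _ _
  have hk1 : (1 : ℝ) ≤ k := by exact_mod_cast hk
  have hM1 : 1 ≤ M := hk1.trans hkM
  -- The scale in `y ≤ T e^{y/T}`, where `y` is the side of a ball. By `hT1`, the growth in `s` of
  -- the `dk`-th power uses only half of the decay `e^{-s/ξ}`; by `hT2`, the part of `y` independent
  -- of `s` costs only `e^{dk}`.
  set T : ℝ := (4 * ξ * d + 2 * r + 5) * M with hT
  have hT0 : 0 < T := by positivity
  have hT1 : 4 * ξ * d * k ≤ T := by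
    have : 4 * ξ * d * k ≤ 4 * ξ * d * M := by gcongr
    have h2 : 0 ≤ (2 * (r : ℝ) + 5) * M := by positivity
    rw [hT]; linarith
  have hT2 : 2 * (2 * (ℓ : ℝ) + r) + 1 ≤ T := by
    have h1 : (r : ℝ) * 1 ≤ r * M := by gcongr
    have h2 : 0 ≤ 4 * ξ * d * M := by positivity
    rw [hT]; linarith
  have hball : ∀ s : ℕ, ((2 * ((2 * ℓ + r + s : ℕ) : ℝ) + 1) ^ d) ^ k ≤
      (T ^ d) ^ k * Real.exp d ^ k * Real.exp ((s : ℝ) / (2 * ξ)) := by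
    intro s
    set y : ℝ := 2 * ((2 * ℓ + r + s : ℕ) : ℝ) + 1 with hy
    have hyT : y ≤ T * Real.exp (y / T) := by
      have h1 : y / T ≤ Real.exp (y / T) := by linarith [Real.add_one_le_exp (y / T)]
      rwa [div_le_iff₀' hT0] at h1
    have hy0 : 0 ≤ y := by positivity
    calc (y ^ d) ^ k ≤ ((T * Real.exp (y / T)) ^ d) ^ k := by gcongr
      _ = (T ^ d) ^ k * Real.exp ((d * k : ℝ) * (y / T)) := by
          rw [mul_pow, mul_pow, ← pow_mul (Real.exp _), ← Real.exp_nat_mul]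
          push_cast
          rfl
      _ ≤ (T ^ d) ^ k * (Real.exp (d * k) * Real.exp ((s : ℝ) / (2 * ξ))) := by
          rw [← Real.exp_add]
          gcongr
          have e1 : y = (2 * (2 * (ℓ : ℝ) + r) + 1) + 2 * s := by
            rw [hy]; push_cast; ring
          have e2 : (d * k : ℝ) * ((2 * (2 * (ℓ : ℝ) + r) + 1) / T) ≤ d * k * 1 := by
            gcongr
            rwa [div_le_one hT0]
          have e3 : (d * k : ℝ) * (2 * s / T) ≤ (s : ℝ) / (2 * ξ) := by
            rw [mul_div_assoc', div_le_div_iff₀ hT0 (by positivity)]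
            calc (d * k : ℝ) * (2 * s) * (2 * ξ) = s * (4 * ξ * d * k) := by ring
              _ ≤ s * T := by gcongr
          rw [e1, add_div, mul_add]
          linarith
      _ = _ := by rw [mul_comm (d : ℝ) k, Real.exp_nat_mul, mul_assoc]
  have hterm : ∀ s ∈ Finset.range S,
      2 ^ (2 * k + 1) * Real.exp (-(s : ℝ) / ξ) *
        ((crowdedWords V (2 * k) (2 * ℓ + r + s)).card : ℝ) ≤
      (2 ^ (2 * k + 1) * (4 ^ k * (k * V.card) ^ k * ((T ^ d) ^ k * Real.exp d ^ k))) *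
        Real.exp (-(s : ℝ) / (2 * ξ)) := by
    intro s _
    have h1 : ((crowdedWords V (2 * k) (2 * ℓ + r + s)).card : ℝ) ≤
        4 ^ k * (k * V.card) ^ k * ((2 * ((2 * ℓ + r + s : ℕ) : ℝ) + 1) ^ d) ^ k := by
      rw [mul_assoc, ← mul_pow]
      exact_mod_cast card_crowdedWords_le V k (2 * ℓ + r + s)
    calc _ ≤ 2 ^ (2 * k + 1) * Real.exp (-(s : ℝ) / ξ) *
          (4 ^ k * (k * V.card) ^ k *
            ((T ^ d) ^ k * Real.exp d ^ k * Real.exp ((s : ℝ) / (2 * ξ)))) := by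
          refine mul_le_mul_of_nonneg_left (h1.trans ?_) (by positivity)
          exact mul_le_mul_of_nonneg_left (hball s) (by positivity)
      _ = (2 ^ (2 * k + 1) * (4 ^ k * (k * V.card) ^ k * ((T ^ d) ^ k * Real.exp d ^ k))) *
          (Real.exp (-(s : ℝ) / ξ) * Real.exp ((s : ℝ) / (2 * ξ))) := by ring
      _ = _ := by
          rw [← Real.exp_add]
          congr 2
          field_simp
          ring
  refine (Finset.sum_le_sum hterm).trans ?_
  rw [← Finset.mul_sum]
  calc _ ≤ (2 ^ (2 * k + 1) * (4 ^ k * (k * V.card) ^ k * ((T ^ d) ^ k * Real.exp d ^ k))) * G :=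
        mul_le_mul_of_nonneg_left (sum_exp_neg_div_le (by positivity) S) (by positivity)
    -- All prefactors are raised to the power `k`, so that they survive the `k`-th root as
    -- constants.
    _ ≤ (8 ^ k * (4 ^ k * (k * V.card) ^ k * ((T ^ d) ^ k * Real.exp d ^ k))) * G ^ k := by
        have h1 : (2 : ℝ) ^ (2 * k + 1) ≤ 8 ^ k := by
          calc (2 : ℝ) ^ (2 * k + 1) ≤ 2 ^ (3 * k) := pow_le_pow_right₀ (by norm_num) (by omega)
            _ = 8 ^ k := by rw [pow_mul]; norm_num
        have h2 : G ≤ G ^ k := le_self_pow₀ hG1 (by omega)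
        gcongr
    _ = _ := by
        rw [momentConst, ← hG, hT]
        simp only [← mul_pow]
        congr 1
        rw [mul_pow]
        ring

/-! ### Expectations in pure states -/

theorem pureExpect_eq_of_hermitian {A : SpinOp V} (hA : A.IsHermitian) (φ : SpinSpace V) :
    inner ℂ φ (Matrix.toEuclideanLin A φ) = (pureExpect φ A : ℂ) := by
  have h := inner_toEuclideanLin_comm hA φ φ
  rw [← inner_conj_symm] at h
  exact (Complex.conj_eq_iff_re.1 h).symm

theorem pureExpect_sub_smul_one {φ : SpinSpace V} (hφ : ‖φ‖ = 1) (A : SpinOp V) (c : ℝ) :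
    pureExpect φ (A - (c : ℂ) • 1) = pureExpect φ A - c := by
  unfold pureExpect
  rw [map_sub, map_smul, LinearMap.sub_apply, LinearMap.smul_apply, toEuclideanLin_one_apply,
    inner_sub_right, inner_smul_right, inner_self_eq_norm_sq_to_K, hφ]
  simp

theorem pureExpect_smul (φ : SpinSpace V) (A : SpinOp V) (c : ℝ) :
    pureExpect φ ((c : ℂ) • A) = c * pureExpect φ A := by
  unfold pureExpect
  rw [map_smul, LinearMap.smul_apply, inner_smul_right]
  simp

/-- The `k`-th power of the norm of `A φ` is at most the norm of `A ^ k φ`. -/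
theorem norm_pow_le_norm_toEuclideanLin_pow {A : SpinOp V} (hA : A.IsHermitian)
    {φ : SpinSpace V} (hφ : ‖φ‖ = 1) (k : ℕ) :
    ‖Matrix.toEuclideanLin A φ‖ ^ k ≤ ‖Matrix.toEuclideanLin (A ^ k) φ‖ := by
  set b : ℕ → ℝ := fun j => ‖Matrix.toEuclideanLin (A ^ j) φ‖ with hb
  have hb0 : ∀ j, 0 ≤ b j := fun j => norm_nonneg _
  -- Cauchy–Schwarz makes `j ↦ ‖A ^ j φ‖` log-convex, so its successive ratios are at least the
  -- first one, `b 1 / b 0 = b 1`.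
  have hlog : ∀ j, b (j + 1) * b (j + 1) ≤ b j * b (j + 2) := by
    intro j
    have h1 : inner ℂ (Matrix.toEuclideanLin (A ^ (j + 1)) φ)
        (Matrix.toEuclideanLin (A ^ (j + 1)) φ) =
        inner ℂ (Matrix.toEuclideanLin (A ^ j) φ) (Matrix.toEuclideanLin (A ^ (j + 2)) φ) := by
      conv_lhs => rw [pow_succ' A j, toEuclideanLin_mul_apply, inner_toEuclideanLin_comm hA,
        ← toEuclideanLin_mul_apply, ← toEuclideanLin_mul_apply]
      rw [pow_succ' A (j + 1), pow_succ' A j, ← mul_assoc]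
    have h2 := norm_inner_le_norm (𝕜 := ℂ) (Matrix.toEuclideanLin (A ^ j) φ)
      (Matrix.toEuclideanLin (A ^ (j + 2)) φ)
    rw [← h1, inner_self_eq_norm_sq_to_K, norm_pow, RCLike.norm_ofReal, abs_norm] at h2
    rw [← pow_two]
    exact h2
  have hstep : ∀ j, b 1 * b j ≤ b (j + 1) := by
    intro j
    induction j with
    | zero => simp [hb, hφ]
    | succ j ih =>
      rcases (hb0 (j + 1)).eq_or_lt with h | h
      · rw [← h, mul_zero]
        exact hb0 _
      · refine le_of_mul_le_mul_right ?_ h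
        calc b 1 * b (j + 1) * b (j + 1) = b 1 * (b (j + 1) * b (j + 1)) := by ring
          _ ≤ b 1 * (b j * b (j + 2)) := mul_le_mul_of_nonneg_left (hlog j) (hb0 1)
          _ = b 1 * b j * b (j + 2) := by ring
          _ ≤ b (j + 1) * b (j + 2) := mul_le_mul_of_nonneg_right ih (hb0 _)
          _ = b (j + 1 + 1) * b (j + 1) := by ring
  have h1 : ‖Matrix.toEuclideanLin A φ‖ = b 1 := by rw [hb]; simp only [pow_one]
  rw [h1]
  induction k with
  | zero => simp [hφ]
  | succ k ih =>
    rw [pow_succ']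
    exact (mul_le_mul_of_nonneg_left ih (hb0 1)).trans (hstep k)

/-- Jensen's inequality for even powers of an observable in a pure state. -/
theorem pureExpect_pow_le {A : SpinOp V} (hA : A.IsHermitian) {φ : SpinSpace V}
    (hφ : ‖φ‖ = 1) (k : ℕ) : pureExpect φ A ^ (2 * k) ≤ pureExpect φ (A ^ (2 * k)) := by
  have h1 : |pureExpect φ A| ≤ ‖Matrix.toEuclideanLin A φ‖ := by
    refine (Complex.abs_re_le_norm _).trans ((norm_inner_le_norm _ _).trans ?_)
    rw [hφ, one_mul]
  have h2 : pureExpect φ (A ^ (2 * k)) = ‖Matrix.toEuclideanLin (A ^ k) φ‖ ^ 2 := by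
    unfold pureExpect
    rw [two_mul, pow_add, toEuclideanLin_mul_apply, ← inner_toEuclideanLin_comm (hA.pow k),
      inner_self_eq_norm_sq_to_K]
    norm_cast
  rw [h2, mul_comm 2 k, pow_mul]
  calc (pureExpect φ A ^ k) ^ 2 = (|pureExpect φ A| ^ k) ^ 2 := by rw [← abs_pow, sq_abs]
    _ ≤ (‖Matrix.toEuclideanLin A φ‖ ^ k) ^ 2 := by gcongr
    _ ≤ _ := by
        gcongr
        exact norm_pow_le_norm_toEuclideanLin_pow hA hφ k

/-! ### The canonical ensemble -/

/-- The Boltzmann weight of the `m`-th eigenstate. -/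
def boltzmann {N : ℕ} (β : ℝ) (en : Fin N → ℝ) (m : Fin N) : ℝ :=
  Real.exp (-β * en m) / ∑ m', Real.exp (-β * en m')

theorem boltzmann_nonneg {N : ℕ} (β : ℝ) (en : Fin N → ℝ) (m : Fin N) : 0 ≤ boltzmann β en m := by
  unfold boltzmann
  positivity

theorem partition_pos {N : ℕ} (hN : 0 < N) (β : ℝ) (en : Fin N → ℝ) :
    0 < ∑ m', Real.exp (-β * en m') :=
  Finset.sum_pos (fun _ _ => Real.exp_pos _) ⟨⟨0, hN⟩, Finset.mem_univ _⟩

theorem sum_boltzmann {N : ℕ} (hN : 0 < N) (β : ℝ) (en : Fin N → ℝ) :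
    ∑ m, boltzmann β en m = 1 := by
  unfold boltzmann
  rw [← Finset.sum_div]
  exact div_self (partition_pos hN β en).ne'

section Ensemble

variable {H : SpinOp V} {ψ : OrthonormalBasis (Fin (2 ^ V.card)) ℂ (SpinSpace V)}
  {en : Fin (2 ^ V.card) → ℝ}

/-- The trace may be taken in the basis `ψ`, where `e^{-βH}` is diagonal. Only diagonal elements of
`A` enter, whichever eigenbasis was chosen in degenerate eigenspaces. -/
theorem expect_gibbs (hψ : IsEigenbasis H ψ en) (β : ℝ) (A : SpinOp V) :
    expect (gibbs β H) A =
      ∑ m, (boltzmann β en m : ℂ) * inner ℂ (ψ m) (Matrix.toEuclideanLin A (ψ m)) := by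
  have hexp : ∀ m, Matrix.toEuclideanLin (NormedSpace.exp (-(β : ℂ) • H)) (ψ m) =
      (Real.exp (-β * en m) : ℂ) • ψ m := by
    intro m
    rw [toEuclideanLin_exp_apply (c := -(β : ℂ) * en m), ← Complex.exp_eq_exp_ℂ]
    · push_cast
      rfl
    · rw [map_smul, LinearMap.smul_apply, hψ m, smul_smul]
  have htr : ∀ B : SpinOp V, (NormedSpace.exp (-(β : ℂ) • H) * B).trace =
      ∑ m, (Real.exp (-β * en m) : ℂ) * inner ℂ (ψ m) (Matrix.toEuclideanLin B (ψ m)) := by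
    intro B
    rw [Matrix.trace_mul_comm, trace_eq_sum_inner_basis ψ]
    refine Finset.sum_congr rfl fun m _ => ?_
    rw [toEuclideanLin_mul_apply, hexp, map_smul, inner_smul_right]
  have hZ : (NormedSpace.exp (-(β : ℂ) • H)).trace = ((∑ m, Real.exp (-β * en m) : ℝ) : ℂ) := by
    have := htr 1
    rw [mul_one] at this
    rw [this]
    push_cast
    refine Finset.sum_congr rfl fun m _ => ?_
    rw [toEuclideanLin_one_apply, inner_self_eq_norm_sq_to_K, ψ.norm_eq_one]
    simp
  unfold expect gibbs
  rw [Matrix.smul_mul, Matrix.trace_smul, htr, hZ, smul_eq_mul, Finset.mul_sum]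
  refine Finset.sum_congr rfl fun m _ => ?_
  rw [boltzmann, Complex.ofReal_div]
  ring

theorem norm_expect_gibbs_le (hψ : IsEigenbasis H ψ en) (β : ℝ) (A : SpinOp V) :
    ‖expect (gibbs β H) A‖ ≤ opNorm A := by
  rw [expect_gibbs hψ]
  calc _ ≤ ∑ m, boltzmann β en m * opNorm A := by
        refine (norm_sum_le _ _).trans (Finset.sum_le_sum fun m _ => ?_)
        rw [norm_mul, Complex.norm_real, Real.norm_of_nonneg (boltzmann_nonneg β en m)]
        exact mul_le_mul_of_nonneg_left (norm_inner_toEuclideanLin_le A (ψ.norm_eq_one m))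
          (boltzmann_nonneg β en m)
    _ = opNorm A := by rw [← Finset.sum_mul, sum_boltzmann (by positivity), one_mul]

theorem expect_gibbs_one (hψ : IsEigenbasis H ψ en) (β : ℝ) : expect (gibbs β H) 1 = 1 := by
  rw [expect_gibbs hψ, ← Complex.ofReal_one, ← sum_boltzmann (by positivity) β en]
  push_cast
  refine Finset.sum_congr rfl fun m _ => ?_
  rw [toEuclideanLin_one_apply, inner_self_eq_norm_sq_to_K, ψ.norm_eq_one]
  simp

theorem expect_gibbs_re (hψ : IsEigenbasis H ψ en) (β : ℝ) (A : SpinOp V) :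
    (expect (gibbs β H) A).re = ∑ m, boltzmann β en m * pureExpect (ψ m) A := by
  rw [expect_gibbs hψ, Complex.re_sum]
  exact Finset.sum_congr rfl fun m _ => Complex.re_ofReal_mul _ _

theorem expect_gibbs_eq_re (hψ : IsEigenbasis H ψ en) (β : ℝ) {A : SpinOp V}
    (hA : A.IsHermitian) : expect (gibbs β H) A = ((expect (gibbs β H) A).re : ℂ) := by
  rw [expect_gibbs_re hψ, expect_gibbs hψ]
  push_cast
  exact Finset.sum_congr rfl fun m _ => by rw [pureExpect_eq_of_hermitian hA]

/-- Concentration of the diagonal matrix elements of an extensive observable with respect to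
the canonical ensemble. -/
theorem exists_gibbs_moment_le (hψ : IsEigenbasis H ψ en) {β ξ : ℝ} (hξ : 0 < ξ) {r ℓ : ℕ}
    (hcl : Clustering r ξ (gibbs β H)) {w : V → SpinOp V} (hw : IsLocalFamily ℓ w) :
    ∃ c : ℝ, ∀ k : ℕ, 1 ≤ k →
      ∑ m, boltzmann β en m * (pureExpect (ψ m) (∑ i, w i) - c) ^ (2 * k) ≤
        (momentConst d r ξ * (k * V.card * (max k ℓ : ℕ) ^ d)) ^ k := by
  set ρ := gibbs β H with hρ
  -- Centering term by term gives each letter mean zero; as `|c i| ≤ 1`, its norm is at most `2`.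
  let c : V → ℝ := fun i => (expect ρ (w i)).re
  let a : V → SpinOp V := fun i => w i - (c i : ℂ) • 1
  have hc : ∀ i, expect ρ (w i) = (c i : ℂ) := fun i => expect_gibbs_eq_re hψ β (hw i).1
  have hsum : ∑ i, a i = ∑ i, w i - ((∑ i, c i : ℝ) : ℂ) • 1 := by
    simp only [a]
    rw [Finset.sum_sub_distrib, ← Finset.sum_smul, Complex.ofReal_sum]
  have hherm : (∑ i, a i).IsHermitian := by
    unfold Matrix.IsHermitian
    rw [hsum, Matrix.conjTranspose_sub, Matrix.conjTranspose_smul, Matrix.conjTranspose_one,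
      Matrix.conjTranspose_sum]
    simp only [fun i => (hw i).1.eq, RCLike.star_def, Complex.conj_ofReal]
  have ha : ∀ i, opNorm (a i) ≤ 2 := by
    intro i
    refine (opNorm_sub_smul_one_le _ _).trans ?_
    have h1 := norm_expect_gibbs_le hψ β (w i)
    rw [← hρ, hc] at h1
    linarith [(hw i).2.1]
  have h0 : ∀ i, expect ρ (a i) = 0 := by
    intro i
    rw [expect_sub, expect_smul, expect_gibbs_one hψ, hc, mul_one, sub_self]
  refine ⟨∑ i, c i, fun k hk => ?_⟩
  refine le_trans ?_ (norm_expect_sum_pow_le hξ (norm_expect_gibbs_le hψ β) hcl ha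
    (fun i => (hw i).2.2.sub ((SupportedOn.one _).smul _)) h0 hk)
  refine le_trans ?_ (Complex.re_le_norm _)
  rw [expect_gibbs_re hψ]
  refine Finset.sum_le_sum fun m _ => mul_le_mul_of_nonneg_left ?_ (boltzmann_nonneg β en m)
  rw [← pureExpect_sub_smul_one (ψ.norm_eq_one m), ← hsum]
  exact pureExpect_pow_le hherm (ψ.norm_eq_one m) k

theorem pureExpect_eigenbasis (hψ : IsEigenbasis H ψ en) (m : Fin (2 ^ V.card)) :
    pureExpect (ψ m) H = en m := by
  unfold pureExpect
  rw [hψ m, inner_smul_right, inner_self_eq_norm_sq_to_K, ψ.norm_eq_one]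
  simp

theorem expect_microState_re (ψ : OrthonormalBasis (Fin (2 ^ V.card)) ℂ (SpinSpace V))
    (en : Fin (2 ^ V.card) → ℝ) (E Δ : ℝ) (A : SpinOp V) :
    (expect (microState ψ en E Δ) A).re =
      (∑ m ∈ shell en E Δ, pureExpect (ψ m) A) / (shell en E Δ).card := by
  have h : ∀ φ : SpinSpace V, (Matrix.vecMulVec φ.ofLp (star φ.ofLp) * A).trace =
      inner ℂ φ (Matrix.toEuclideanLin A φ) := by
    intro φ
    rw [Matrix.trace_mul_comm, Matrix.mul_vecMulVec, Matrix.trace_vecMulVec]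
    rfl
  unfold expect microState
  rw [Matrix.smul_mul, Matrix.trace_smul, Finset.sum_mul, Matrix.trace_sum]
  simp only [h, smul_eq_mul]
  rw [← Complex.ofReal_natCast, ← Complex.ofReal_inv, Complex.re_ofReal_mul, Complex.re_sum,
    div_eq_inv_mul]
  rfl

end Ensemble

/-! ### The weight of an energy shell -/

theorem mem_shell {N : ℕ} {en : Fin N → ℝ} {E Δ : ℝ} {m : Fin N} :
    m ∈ shell en E Δ ↔ E - Δ < en m ∧ en m ≤ E := by
  simp [shell]

/-- A shell whose upper end is an eigenvalue already has positive weight. -/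
theorem MaximizesShellWeight.card_pos {N : ℕ} (hN : 0 < N) {en : Fin N → ℝ} {β Δ E : ℝ}
    (hΔ : 0 < Δ) (h : MaximizesShellWeight en β Δ E) : 0 < (shell en E Δ).card := by
  by_contra! h0
  have h1 := h (en ⟨0, hN⟩)
  rw [Nat.le_zero.1 h0, Nat.cast_zero, mul_zero] at h1
  have h2 : 0 < (shell en (en ⟨0, hN⟩) Δ).card :=
    Finset.card_pos.2 ⟨⟨0, hN⟩, mem_shell.2 ⟨by linarith, le_rfl⟩⟩
  have h3 : (0 : ℝ) < (shell en (en ⟨0, hN⟩) Δ).card := by exact_mod_cast h2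
  have h4 := Real.exp_pos (-β * en ⟨0, hN⟩)
  nlinarith

/-- At negative inverse temperature the shell weight has no maximizer, since the shell is open
at its lower end. -/
theorem MaximizesShellWeight.beta_nonneg {N : ℕ} (hN : 0 < N) {en : Fin N → ℝ} {β Δ E : ℝ}
    (hΔ : 0 < Δ) (h : MaximizesShellWeight en β Δ E) : 0 ≤ β := by
  by_contra! hβ
  have hpos := h.card_pos hN hΔ
  obtain ⟨m₀, hm₀, hmin⟩ := (shell en E Δ).exists_min_image en (Finset.card_pos.1 hpos)
  have hm₀' := mem_shell.1 hm₀
  -- Raising the shell by half the gap below its lowest level loses no state, while `e^{-βE}` grows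
  -- when `β < 0`.
  set ε := (en m₀ - (E - Δ)) / 2 with hε
  have hε0 : 0 < ε := by rw [hε]; linarith [hm₀'.1]
  have hsub : shell en E Δ ⊆ shell en (E + ε) Δ := by
    intro m hm
    have h1 := mem_shell.1 hm
    have h2 := hmin m hm
    refine mem_shell.2 ⟨?_, by linarith [h1.2]⟩
    rw [hε]
    linarith [hm₀'.1]
  have h1 := h (E + ε)
  have h2 : ((shell en E Δ).card : ℝ) ≤ (shell en (E + ε) Δ).card := by
    exact_mod_cast Finset.card_le_card hsub
  have h3 : (0 : ℝ) < (shell en E Δ).card := by exact_mod_cast hpos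
  have h4 : Real.exp (-β * E) < Real.exp (-β * (E + ε)) := by
    rw [Real.exp_lt_exp]
    nlinarith
  have h5 : Real.exp (-β * (E + ε)) * ((shell en E Δ).card : ℝ) ≤
      Real.exp (-β * (E + ε)) * ((shell en (E + ε) Δ).card : ℝ) := by gcongr
  have h6 := mul_lt_mul_of_pos_right h4 h3
  linarith

/-- Summing the inverse ranks of the elements of a finite set gives at most a harmonic number. -/
theorem sum_inv_rank_le_harmonic {ι : Type*} [DecidableEq ι] (f : ι → ℝ) (s : Finset ι) :
    ∑ m ∈ s, (((s.filter fun m' => f m' ≤ f m).card : ℝ))⁻¹ ≤ (harmonic s.card : ℝ) := by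
  induction s using Finset.strongInduction with
  | H s ih =>
    rcases s.eq_empty_or_nonempty with rfl | hne
    · simp
    -- The largest element has rank `s.card`, the new term of the harmonic sum; removing it cannot
    -- increase the other ranks.
    · obtain ⟨m₀, hm₀, hmax⟩ := s.exists_max_image f hne
      have hall : s.filter (fun m' => f m' ≤ f m₀) = s := Finset.filter_true_of_mem hmax
      rw [← Finset.sum_erase_add _ _ hm₀, hall]
      have hcard : s.card = (s.erase m₀).card + 1 := (Finset.card_erase_add_one hm₀).symm
      rw [hcard, harmonic_succ]
      push_cast
      refine add_le_add (le_trans (Finset.sum_le_sum fun m hm => ?_)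
        (ih (s.erase m₀) (Finset.erase_ssubset hm₀))) le_rfl
      have hsub : (s.erase m₀).filter (fun m' => f m' ≤ f m) ⊆ s.filter fun m' => f m' ≤ f m :=
        Finset.filter_subset_filter _ (Finset.erase_subset _ _)
      have hpos : 0 < ((s.erase m₀).filter fun m' => f m' ≤ f m).card :=
        Finset.card_pos.2 ⟨m, Finset.mem_filter.2 ⟨hm, le_rfl⟩⟩
      exact inv_anti₀ (by exact_mod_cast hpos) (by exact_mod_cast Finset.card_le_card hsub)

/-- The Boltzmann weight of a shell of bounded width. -/
theorem sum_shell_exp_le_exp {N : ℕ} {en : Fin N → ℝ} {β Δ E : ℝ} (hβ : 0 ≤ β)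
    (h : MaximizesShellWeight en β Δ E) (b : ℝ) :
    ∑ m ∈ shell en b Δ, Real.exp (-β * en m) ≤
      Real.exp (-β * E) * (shell en E Δ).card * Real.exp (β * Δ) := by
  calc ∑ m ∈ shell en b Δ, Real.exp (-β * en m)
      ≤ ∑ m ∈ shell en b Δ, Real.exp (-β * b) * Real.exp (β * Δ) := by
        refine Finset.sum_le_sum fun m hm => ?_
        rw [← Real.exp_add, Real.exp_le_exp]
        nlinarith [(mem_shell.1 hm).1]
    _ = Real.exp (-β * b) * (shell en b Δ).card * Real.exp (β * Δ) := by
        rw [Finset.sum_const, nsmul_eq_mul]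
        ring
    _ ≤ _ := mul_le_mul_of_nonneg_right (h b) (Real.exp_pos _).le

/-- The Boltzmann weight of a shell, with a factor that does not depend on the temperature. -/
theorem sum_shell_exp_le_log {N : ℕ} {en : Fin N → ℝ} {β Δ E : ℝ}
    (h : MaximizesShellWeight en β Δ E) (b : ℝ) :
    ∑ m ∈ shell en b Δ, Real.exp (-β * en m) ≤
      Real.exp (-β * E) * (shell en E Δ).card * (1 + Real.log N) := by
  classical
  set W := Real.exp (-β * E) * ((shell en E Δ).card : ℝ) with hW
  have hW0 : 0 ≤ W := by positivity
  calc ∑ m ∈ shell en b Δ, Real.exp (-β * en m)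
      ≤ ∑ m ∈ shell en b Δ,
          -- The shell ending at `en m` contains all states of the given shell up to `en m`, so
          -- maximality bounds `e^{-β en m}` by `W` over the rank of `m`.
          W * ((((shell en b Δ).filter fun m' => en m' ≤ en m).card : ℝ))⁻¹ := by
        refine Finset.sum_le_sum fun m hm => ?_
        have hpos : 0 < ((shell en b Δ).filter fun m' => en m' ≤ en m).card :=
          Finset.card_pos.2 ⟨m, Finset.mem_filter.2 ⟨hm, le_rfl⟩⟩
        rw [← div_eq_mul_inv, le_div_iff₀ (by exact_mod_cast hpos)]
        refine le_trans ?_ (h (en m))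
        refine mul_le_mul_of_nonneg_left ?_ (Real.exp_pos _).le
        refine Nat.cast_le.2 (Finset.card_le_card fun m' hm' => ?_)
        obtain ⟨h1, h2⟩ := Finset.mem_filter.1 hm'
        have h3 := mem_shell.1 h1
        have h4 := mem_shell.1 hm
        exact mem_shell.2 ⟨by linarith, h2⟩
    _ ≤ W * (harmonic (shell en b Δ).card : ℝ) := by
        rw [← Finset.mul_sum]
        exact mul_le_mul_of_nonneg_left (sum_inv_rank_le_harmonic en _) hW0
    _ ≤ W * (1 + Real.log N) := by
        refine mul_le_mul_of_nonneg_left ?_ hW0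
        rcases Nat.eq_zero_or_pos (shell en b Δ).card with h0 | hpos
        · rw [h0]
          have : 0 ≤ Real.log N := Real.log_natCast_nonneg N
          simp only [harmonic_zero, Rat.cast_zero]
          linarith
        · refine (harmonic_le_one_add_log _).trans ?_
          have hle : ((shell en b Δ).card : ℝ) ≤ N := by
            exact_mod_cast (Finset.card_le_univ _).trans_eq (Fintype.card_fin N)
          have : (0 : ℝ) < (shell en b Δ).card := by exact_mod_cast hpos
          gcongr

/-- If the energy has variance at most `s ^ 2` in the canonical ensemble then the partition
function is controlled by the shells that meet a window of width of order `s`. -/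
theorem partition_le_of_variance_le {N : ℕ} (hN : 0 < N) {en : Fin N → ℝ} {β Δ c s B : ℝ}
    (hΔ : 0 < Δ) (hs : 0 < s)
    (hvar : ∑ m, boltzmann β en m * (en m - c) ^ 2 ≤ s ^ 2)
    (hB : ∀ b, ∑ m ∈ shell en b Δ, Real.exp (-β * en m) ≤ B) :
    ∑ m, Real.exp (-β * en m) ≤ 2 * (4 * s / Δ + 2) * B := by
  classical
  set Z := ∑ m, Real.exp (-β * en m) with hZ
  have hZ0 : 0 < Z := partition_pos hN β en
  set I : Finset (Fin N) := Finset.univ.filter fun m => |en m - c| ≤ 2 * s with hI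
  have hB0 : 0 ≤ B := le_trans (Finset.sum_nonneg fun _ _ => (Real.exp_pos _).le) (hB 0)
  have hout : ∑ m ∈ Iᶜ, Real.exp (-β * en m) ≤ Z / 2 := by
    -- Chebyshev: energies further than `2s` from `c` carry at most a quarter of the weight.
    have h1 : ∑ m ∈ Iᶜ, boltzmann β en m * (4 * s ^ 2) ≤ s ^ 2 := by
      refine le_trans (Finset.sum_le_sum fun m hm => ?_)
        ((Finset.sum_le_univ_sum_of_nonneg fun m => ?_).trans hvar)
      · refine mul_le_mul_of_nonneg_left ?_ (boltzmann_nonneg β en m)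
        have h2 : 2 * s < |en m - c| := by
          have := Finset.mem_compl.1 hm
          rw [hI, Finset.mem_filter] at this
          push Not at this
          exact this (Finset.mem_univ _)
        rw [← sq_abs (en m - c)]
        nlinarith
      · exact mul_nonneg (boltzmann_nonneg β en m) (sq_nonneg _)
    rw [← Finset.sum_mul] at h1
    have h2 : ∑ m ∈ Iᶜ, boltzmann β en m = (∑ m ∈ Iᶜ, Real.exp (-β * en m)) / Z := by
      rw [Finset.sum_div]
      rfl
    rw [h2] at h1
    have hs2 : 0 < s ^ 2 := by positivity
    have h3 : (∑ m ∈ Iᶜ, Real.exp (-β * en m)) / Z ≤ 1 / 4 := by nlinarith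
    rw [div_le_iff₀ hZ0] at h3
    linarith
  have hsplit : Z = ∑ m ∈ I, Real.exp (-β * en m) + ∑ m ∈ Iᶜ, Real.exp (-β * en m) :=
    (Finset.sum_add_sum_compl I _).symm
  -- The window is cut into shells closed at the top. The extra bin `0` catches an energy exactly at
  -- `c - 2 * s`, whence `J + 1` bins.
  set J := ⌈4 * s / Δ⌉₊ with hJ
  let bin : Fin N → ℕ := fun m => ⌈(en m - (c - 2 * s)) / Δ⌉₊
  have hmaps : ∀ m ∈ I, bin m ∈ Finset.range (J + 1) := by
    intro m hm
    have h1 := abs_le.1 (Finset.mem_filter.1 hm).2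
    refine Finset.mem_range.2 (Nat.lt_succ_of_le (Nat.ceil_mono ?_))
    gcongr
    linarith [h1.2]
  have hbin : ∀ m ∈ I, m ∈ shell en (c - 2 * s + bin m * Δ) Δ := by
    intro m hm
    have h1 := abs_le.1 (Finset.mem_filter.1 hm).2
    have h0 : 0 ≤ (en m - (c - 2 * s)) / Δ := div_nonneg (by linarith [h1.1]) hΔ.le
    have h2 := Nat.le_ceil ((en m - (c - 2 * s)) / Δ)
    have h3 := Nat.ceil_lt_add_one h0
    rw [div_le_iff₀ hΔ] at h2
    have h4 := mul_lt_mul_of_pos_right h3 hΔ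
    rw [add_mul, div_mul_cancel₀ _ hΔ.ne'] at h4
    exact mem_shell.2 ⟨by linarith, by linarith⟩
  have hin : ∑ m ∈ I, Real.exp (-β * en m) ≤ (4 * s / Δ + 2) * B := by
    rw [← Finset.sum_fiberwise_of_maps_to hmaps]
    calc ∑ j ∈ Finset.range (J + 1), ∑ m ∈ I with bin m = j, Real.exp (-β * en m)
        ≤ ∑ j ∈ Finset.range (J + 1), ∑ m ∈ shell en (c - 2 * s + j * Δ) Δ,
            Real.exp (-β * en m) := by
          refine Finset.sum_le_sum fun j _ => Finset.sum_le_sum_of_subset_of_nonneg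
            (fun m hm => ?_) fun _ _ _ => (Real.exp_pos _).le
          obtain ⟨hmI, rfl⟩ := Finset.mem_filter.1 hm
          exact hbin m hmI
      _ ≤ ∑ j ∈ Finset.range (J + 1), B := Finset.sum_le_sum fun j _ => hB _
      _ = ((J : ℝ) + 1) * B := by simp
      _ ≤ _ := by
          have : (J : ℝ) < 4 * s / Δ + 1 := Nat.ceil_lt_add_one (by positivity)
          exact mul_le_mul_of_nonneg_right (by linarith) hB0
  linarith

/-- Averages over the shell are controlled by averages in the canonical ensemble. -/
theorem shell_average_le {N : ℕ} (hN : 0 < N) {en : Fin N → ℝ} {β Δ E Q : ℝ} (hβ : 0 ≤ β)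
    (hE : 0 < (shell en E Δ).card)
    (hQ : ∑ m, Real.exp (-β * en m) ≤ Q * (Real.exp (-β * E) * (shell en E Δ).card))
    {g : Fin N → ℝ} (hg : ∀ m, 0 ≤ g m) :
    ∑ m ∈ shell en E Δ, ((shell en E Δ).card : ℝ)⁻¹ * g m ≤ Q * ∑ m, boltzmann β en m * g m := by
  set Z := ∑ m, Real.exp (-β * en m) with hZ
  have hZ0 : 0 < Z := partition_pos hN β en
  have hE' : (0 : ℝ) < (shell en E Δ).card := by exact_mod_cast hE
  have hsub : ∑ m ∈ shell en E Δ, Q * (boltzmann β en m * g m) ≤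
      Q * ∑ m, boltzmann β en m * g m := by
    have hQ0 : 0 ≤ Q := by
      by_contra! hneg
      have h1 : 0 < Real.exp (-β * E) * ((shell en E Δ).card : ℝ) := by positivity
      nlinarith
    rw [← Finset.mul_sum]
    exact mul_le_mul_of_nonneg_left (Finset.sum_le_univ_sum_of_nonneg fun m =>
      mul_nonneg (boltzmann_nonneg β en m) (hg m)) hQ0
  refine le_trans (Finset.sum_le_sum fun m hm => ?_) hsub
  rw [← mul_assoc]
  refine mul_le_mul_of_nonneg_right ?_ (hg m)
  -- This is where `β ≥ 0` enters: energies in the shell are at most `E`.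
  have hexp : Real.exp (-β * E) ≤ Real.exp (-β * en m) := by
    rw [Real.exp_le_exp]
    nlinarith [(mem_shell.1 hm).2]
  have hbol : boltzmann β en m = Real.exp (-β * en m) / Z := rfl
  have hQ0 : 0 < Q * (Real.exp (-β * E) * ((shell en E Δ).card : ℝ)) := hZ0.trans_le hQ
  have hQ1 : 0 < Q := pos_of_mul_pos_left hQ0 (by positivity)
  rw [hbol, mul_div_assoc', le_div_iff₀ hZ0, inv_mul_le_iff₀ hE']
  calc Z ≤ Q * (Real.exp (-β * E) * ((shell en E Δ).card : ℝ)) := hQ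
    _ ≤ Q * (Real.exp (-β * en m) * ((shell en E Δ).card : ℝ)) := by gcongr
    _ = _ := by ring

/-- The variance minimizes the mean squared deviation. -/
theorem sum_sub_mean_sq_le {ι : Type*} (s : Finset ι) (f : ι → ℝ) (c : ℝ) :
    ∑ m ∈ s, (f m - (∑ m ∈ s, f m) / s.card) ^ 2 / (s.card : ℝ) ≤
      ∑ m ∈ s, (s.card : ℝ)⁻¹ * (f m - c) ^ 2 := by
  rcases s.eq_empty_or_nonempty with rfl | hne
  · simp
  have hcard : (s.card : ℝ) ≠ 0 := by exact_mod_cast hne.card_pos.ne'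
  set μ := (∑ m ∈ s, f m) / (s.card : ℝ) with hμ
  have hsum : ∑ m ∈ s, (f m - μ) = 0 := by
    rw [Finset.sum_sub_distrib, Finset.sum_const, nsmul_eq_mul, hμ, mul_div_cancel₀ _ hcard,
      sub_self]
  rw [← Finset.sum_div, ← Finset.mul_sum, div_eq_inv_mul]
  refine mul_le_mul_of_nonneg_left ?_ (by positivity)
  have hexp : ∑ m ∈ s, (f m - c) ^ 2 =
      ∑ m ∈ s, (f m - μ) ^ 2 + 2 * (μ - c) * ∑ m ∈ s, (f m - μ) + s.card * (μ - c) ^ 2 := by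
    rw [Finset.mul_sum, ← Finset.sum_add_distrib, ← nsmul_eq_mul, ← Finset.sum_const,
      ← Finset.sum_add_distrib]
    exact Finset.sum_congr rfl fun m _ => by ring
  rw [hexp, hsum]
  have : 0 ≤ (s.card : ℝ) * (μ - c) ^ 2 := by positivity
  linarith

/-! ### The variance over an energy shell -/

/-- Moment bound for the shell variance: `Q` compares the partition function with the weight of
the shell. -/
theorem shellVar_le_of_partition_le {r ℓ₀ ℓ : ℕ} {ξ : ℝ} (hξ : 0 < ξ) {h w : V → SpinOp V}
    {ψ : OrthonormalBasis (Fin (2 ^ V.card)) ℂ (SpinSpace V)} {en : Fin (2 ^ V.card) → ℝ}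
    {β E Δ : ℝ} (hsys : IsShellOfClusteringSystem r ℓ₀ ℓ ξ h w ψ en β E Δ)
    {Q : ℝ} (hQ0 : 0 ≤ Q) {k : ℕ} (hk : 1 ≤ k)
    (hQ : ∑ m, Real.exp (-β * en m) ≤ Q ^ k * (Real.exp (-β * E) * (shell en E Δ).card)) :
    shellVar ψ en E Δ ((V.card : ℂ)⁻¹ • ∑ i, w i) ≤
      1 / (V.card : ℝ) * (Q * momentConst d r ξ * (k * (max k ℓ : ℕ) ^ d)) := by
  have hN : 0 < 2 ^ V.card := by positivity
  have hβ := hsys.maximizes.beta_nonneg hN hsys.width_pos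
  have hE := hsys.maximizes.card_pos hN hsys.width_pos
  obtain ⟨c, hc⟩ := exists_gibbs_moment_le hsys.eigenbasis hξ hsys.clustering hsys.obs_local
  set n : ℝ := (V.card : ℝ) with hn
  set S := shell en E Δ with hS
  set g : Fin (2 ^ V.card) → ℝ := fun m => pureExpect (ψ m) (∑ i, w i) with hg
  set B : ℝ := momentConst d r ξ * (k * n * (max k ℓ : ℕ) ^ d) with hB
  have hM := momentConst_pos d r hξ
  have hB0 : 0 ≤ B := by positivity
  have hshift : ∀ m, pureExpect (ψ m) ((V.card : ℂ)⁻¹ • ∑ i, w i) = n⁻¹ * g m := by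
    intro m
    rw [← pureExpect_smul, hn]
    push_cast
    rfl
  -- Jensen for `t ↦ t ^ k` is applied before changing ensembles, so the factor `Q ^ k` contributes
  -- only `Q` after the root.
  have hpow : (∑ m ∈ S, (S.card : ℝ)⁻¹ * (g m - c) ^ 2) ^ k ≤ (Q * B) ^ k := by
    have hE' : (S.card : ℝ) ≠ 0 := by exact_mod_cast hE.ne'
    have h1 := Real.pow_arith_mean_le_arith_mean_pow S (fun _ => (S.card : ℝ)⁻¹)
      (fun m => (g m - c) ^ 2) (fun _ _ => by positivity)
      (by rw [Finset.sum_const, nsmul_eq_mul, mul_inv_cancel₀ hE'])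
      (fun _ _ => sq_nonneg _) k
    refine h1.trans ?_
    simp only [← pow_mul]
    refine (shell_average_le hN hβ hE hQ
      (g := fun m => (g m - c) ^ (2 * k)) fun m => (even_two_mul k).pow_nonneg _).trans ?_
    rw [mul_pow]
    exact mul_le_mul_of_nonneg_left (hc k hk) (by positivity)
  have hsq : ∑ m ∈ S, (S.card : ℝ)⁻¹ * (g m - c) ^ 2 ≤ Q * B :=
    le_of_pow_le_pow_left₀ (by omega) (by positivity) hpow
  unfold shellVar
  rw [expect_microState_re]
  refine (sum_sub_mean_sq_le S _ (n⁻¹ * c)).trans ?_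
  calc ∑ m ∈ S, (S.card : ℝ)⁻¹ *
        (pureExpect (ψ m) ((V.card : ℂ)⁻¹ • ∑ i, w i) - n⁻¹ * c) ^ 2
      = n⁻¹ ^ 2 * ∑ m ∈ S, (S.card : ℝ)⁻¹ * (g m - c) ^ 2 := by
        rw [Finset.mul_sum]
        refine Finset.sum_congr rfl fun m _ => ?_
        rw [hshift]
        ring
    _ ≤ n⁻¹ ^ 2 * (Q * B) := mul_le_mul_of_nonneg_left hsq (by positivity)
    _ = _ := by
        rw [hB]
        rcases eq_or_ne n 0 with h0 | h0
        · simp [h0]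
        · field_simp

/-- The constant in the bound on the ratio of the partition function and the shell weight. -/
def partitionConst (d r ℓ₀ : ℕ) (ξ K : ℝ) : ℝ :=
  2 * (4 * √(momentConst d r ξ * (max 1 ℓ₀ : ℕ) ^ d) + 2) * (Real.exp K + 2 * K ^ K)

theorem one_le_partitionConst (d r ℓ₀ : ℕ) {ξ K : ℝ} (hK : 1 ≤ K) :
    1 ≤ partitionConst d r ℓ₀ ξ K := by
  have h1 := Real.sqrt_nonneg (momentConst d r ξ * (max 1 ℓ₀ : ℕ) ^ d)
  have h2 : 1 ≤ Real.exp K := Real.one_le_exp (by linarith)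
  have h3 : 0 ≤ K ^ K := Real.rpow_nonneg (by linarith) _
  unfold partitionConst
  nlinarith

/-- The partition function exceeds the weight of the shell at most by a power of `√n / Δ`. -/
theorem partition_le_shell_weight {r ℓ₀ ℓ : ℕ} {ξ : ℝ} (hξ : 0 < ξ) {h w : V → SpinOp V}
    {ψ : OrthonormalBasis (Fin (2 ^ V.card)) ℂ (SpinSpace V)} {en : Fin (2 ^ V.card) → ℝ}
    {β E Δ K : ℝ} (hK : 1 ≤ K) (hsys : IsShellOfClusteringSystem r ℓ₀ ℓ ξ h w ψ en β E Δ)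
    (hwidth : AdmissibleWidth K V.card β Δ) :
    ∑ m, Real.exp (-β * en m) ≤ partitionConst d r ℓ₀ ξ K * (√(V.card : ℝ) / Δ) ^ (K + 1) *
      (Real.exp (-β * E) * (shell en E Δ).card) := by
  have hN : 0 < 2 ^ V.card := by positivity
  have hK0 : 0 < K := by linarith
  have hΔ := hsys.width_pos
  have hβ := hsys.maximizes.beta_nonneg hN hΔ
  obtain ⟨c, hc⟩ := exists_gibbs_moment_le hsys.eigenbasis hξ hsys.clustering hsys.ham_local
  set n : ℝ := (V.card : ℝ) with hn
  set x : ℝ := √n / Δ with hx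
  have hx1 : 1 ≤ x := by
    have : 0 < 1 / K := by positivity
    linarith [hwidth.1]
  have hn0 : 0 < n := by
    by_contra! hcon
    have : n = 0 := le_antisymm hcon (by positivity)
    rw [hx, this] at hx1
    norm_num at hx1
  have hn1 : 1 ≤ n := by
    rw [hn] at hn0 ⊢
    exact_mod_cast hn0
  set W := Real.exp (-β * E) * ((shell en E Δ).card : ℝ) with hW
  have hW0 : 0 ≤ W := by positivity
  set m₀ := √(momentConst d r ξ * (max 1 ℓ₀ : ℕ) ^ d) with hm₀
  have hM := momentConst_pos d r hξ
  have hm₀pos : 0 < m₀ := by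
    rw [hm₀]
    refine Real.sqrt_pos.2 (mul_pos hM (pow_pos ?_ d))
    exact_mod_cast lt_of_lt_of_le one_pos (le_max_left 1 ℓ₀)
  -- The moment bound with `k = 1`, applied to the Hamiltonian itself.
  have hvar : ∑ m, boltzmann β en m * (en m - c) ^ 2 ≤ (m₀ * √n) ^ 2 := by
    have h1 := hc 1 le_rfl
    simp only [pureExpect_eigenbasis hsys.eigenbasis, mul_one, pow_one, Nat.cast_one,
      one_mul] at h1
    refine h1.trans_eq ?_
    rw [mul_pow, hm₀, Real.sq_sqrt (by positivity), Real.sq_sqrt hn0.le]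
    ring
  have hxK : 1 ≤ x ^ K := Real.one_le_rpow hx1 hK0.le
  have hKK : 0 ≤ K ^ K := Real.rpow_nonneg hK0.le _
  have hB : ∀ b, ∑ m ∈ shell en b Δ, Real.exp (-β * en m) ≤
      W * ((Real.exp K + 2 * K ^ K) * x ^ K) := by
    intro b
    rcases hwidth.2 with hcase | hcase
    · refine (sum_shell_exp_le_exp hβ hsys.maximizes b).trans
        (mul_le_mul_of_nonneg_left ?_ hW0)
      calc Real.exp (β * Δ) ≤ Real.exp K * 1 := by rw [mul_one]; exact Real.exp_le_exp.2 hcase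
        _ ≤ (Real.exp K + 2 * K ^ K) * x ^ K := by
            gcongr
            linarith
    · refine (sum_shell_exp_le_log hsys.maximizes b).trans
        (mul_le_mul_of_nonneg_left ?_ hW0)
      -- Without control of `βΔ` each shell costs a factor `1 + log (2 ^ n) ≤ 2n`; here `Δ` is small
      -- enough that `n` is itself bounded by a power of `x`.
      have h1 : n ^ (1 / K) ≤ K * x := by
        have h2 : n ^ (1 / K) * n ^ (1 / 2 - 1 / K) = √n := by
          rw [← Real.rpow_add hn0, Real.sqrt_eq_rpow]
          congr 1
          ring
        rw [hx, mul_div_assoc', le_div_iff₀ hΔ, ← h2]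
        calc n ^ (1 / K) * Δ ≤ n ^ (1 / K) * (K * n ^ (1 / 2 - 1 / K)) := by gcongr
          _ = _ := by ring
      have h3 : n ≤ K ^ K * x ^ K := by
        rw [← Real.mul_rpow hK0.le (by linarith)]
        calc n = (n ^ (1 / K)) ^ K := by
              rw [← Real.rpow_mul hn0.le, one_div_mul_cancel hK0.ne', Real.rpow_one]
          _ ≤ _ := by gcongr
      have h4 : Real.log ((2 ^ V.card : ℕ) : ℝ) ≤ n := by
        rw [Nat.cast_pow, Real.log_pow, ← hn]
        have : Real.log ((2 : ℕ) : ℝ) ≤ 1 := by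
          have := Real.log_two_lt_d9
          push_cast
          linarith
        exact mul_le_of_le_one_right hn0.le this
      calc 1 + Real.log ((2 ^ V.card : ℕ) : ℝ) ≤ 2 * n := by linarith
        _ ≤ 2 * (K ^ K * x ^ K) := by gcongr
        _ = (2 * K ^ K) * x ^ K := by ring
        _ ≤ _ := by
            gcongr
            linarith [Real.exp_pos K]
  refine (partition_le_of_variance_le hN hΔ (by positivity) hvar hB).trans ?_
  have h5 : 4 * (m₀ * √n) / Δ + 2 ≤ (4 * m₀ + 2) * x := by
    have : 4 * (m₀ * √n) / Δ = 4 * m₀ * x := by rw [hx]; ring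
    rw [this]
    linarith
  calc 2 * (4 * (m₀ * √n) / Δ + 2) * (W * ((Real.exp K + 2 * K ^ K) * x ^ K))
      ≤ 2 * ((4 * m₀ + 2) * x) * (W * ((Real.exp K + 2 * K ^ K) * x ^ K)) := by gcongr
    _ = _ := by
        rw [partitionConst, Real.rpow_add (by linarith), Real.rpow_one]
        ring

/-! ### Choice of the moment order and the final bounds -/

theorem boundOne_sq {n : ℕ} {Δ : ℝ} (h : 0 ≤ Real.log (√(n : ℝ) / Δ)) :
    boundOne d n Δ ^ 2 = Real.log (√(n : ℝ) / Δ) ^ (d + 1) := by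
  unfold boundOne
  rw [← Real.rpow_natCast, ← Real.rpow_mul h, ← Real.rpow_natCast]
  congr 1
  push_cast
  ring

theorem boundTwo_sq {n ℓ : ℕ} {Δ : ℝ} (h : 0 ≤ Real.log (√(n : ℝ) / Δ)) :
    boundTwo d n ℓ Δ ^ 2 = (ℓ : ℝ) ^ d * Real.log (√(n : ℝ) / Δ) := by
  unfold boundTwo
  rw [← Real.sqrt_eq_rpow, Real.sq_sqrt (by positivity)]

/-- The first bound of the main theorem. -/
theorem exists_shellVar_le_max (d r ℓ₀ : ℕ) {ξ : ℝ} (hξ : 0 < ξ) {K : ℝ} (hK : 1 ≤ K) :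
    ∃ c₁ c₂ : ℝ, 0 < c₁ ∧ 0 < c₂ ∧
      ∀ (ℓ : ℕ) (V : Finset (Fin d → ℤ)) (h w : V → SpinOp V)
        (ψ : OrthonormalBasis (Fin (2 ^ V.card)) ℂ (SpinSpace V)) (en : Fin (2 ^ V.card) → ℝ)
        (β E Δ : ℝ),
        IsShellOfClusteringSystem r ℓ₀ ℓ ξ h w ψ en β E Δ →
        AdmissibleWidth K V.card β Δ →
        shellVar ψ en E Δ ((V.card : ℂ)⁻¹ • ∑ i, w i)
          ≤ 1 / (V.card : ℝ) *
            max (c₁ * boundOne d V.card Δ ^ 2) (c₂ * boundTwo d V.card ℓ Δ ^ 2) := by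
  have hK0 : 0 < K := by linarith
  set P := partitionConst d r ℓ₀ ξ K with hP
  have hP1 : 1 ≤ P := one_le_partitionConst d r ℓ₀ hK
  have hM := momentConst_pos d r hξ
  have hlog : 0 < Real.log (1 + 1 / K) := Real.log_pos (by
    have : 0 < 1 / K := by positivity
    linarith)
  -- Absorbs the rounding in `k = ⌈log x⌉`: as `x ≥ 1 + 1 / K`, the added `1` is at most `log x /
  -- log (1 + 1 / K)`.
  set κ : ℝ := 1 + 1 / Real.log (1 + 1 / K) with hκ
  have hκ0 : 0 < κ := by positivity
  set C : ℝ := P * Real.exp (K + 1) * momentConst d r ξ with hC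
  have hC0 : 0 < C := by positivity
  refine ⟨C * κ ^ (d + 1), C * κ, by positivity, by positivity, ?_⟩
  intro ℓ V h w ψ en β E Δ hsys hwidth
  set x : ℝ := √(V.card : ℝ) / Δ with hx
  have hx0 : 0 < 1 + 1 / K := by positivity
  have hxpos : 0 < x := hx0.trans_le hwidth.1
  have hL : Real.log (1 + 1 / K) ≤ Real.log x := Real.log_le_log hx0 hwidth.1
  have hL0 : 0 < Real.log x := hlog.trans_le hL
  -- With this order `x ^ (K + 1) ≤ e^{(K + 1) k}`, so the comparison factor has a bounded `k`-th
  -- root.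
  set k := ⌈Real.log x⌉₊ with hk
  have hk1 : 1 ≤ k := Nat.one_le_ceil_iff.2 hL0
  have hkκ : (k : ℝ) ≤ κ * Real.log x := by
    have h1 : (k : ℝ) < Real.log x + 1 := Nat.ceil_lt_add_one hL0.le
    have h2 : 1 ≤ 1 / Real.log (1 + 1 / K) * Real.log x := by
      rw [one_div_mul_eq_div, one_le_div hlog]
      exact hL
    rw [hκ, add_mul, one_mul]
    linarith
  have hpart : ∑ m, Real.exp (-β * en m) ≤
      (P * Real.exp (K + 1)) ^ k * (Real.exp (-β * E) * (shell en E Δ).card) := by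
    refine (partition_le_shell_weight hξ hK hsys hwidth).trans
      (mul_le_mul_of_nonneg_right ?_ (by positivity))
    rw [mul_pow]
    have h1 : P ≤ P ^ k := le_self_pow₀ hP1 (by omega)
    have h2 : x ^ (K + 1) ≤ Real.exp (K + 1) ^ k := by
      rw [Real.rpow_def_of_pos hxpos, ← Real.exp_nat_mul, Real.exp_le_exp]
      exact mul_le_mul_of_nonneg_right (Nat.le_ceil _) (by linarith)
    gcongr
  refine (shellVar_le_of_partition_le hξ hsys (by positivity) hk1 hpart).trans ?_
  refine mul_le_mul_of_nonneg_left ?_ (by positivity)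
  rw [boundOne_sq hL0.le, boundTwo_sq hL0.le, ← hx, ← hC]
  rcases le_total ℓ k with hle | hle
  · refine le_max_of_le_left ?_
    rw [max_eq_left hle, mul_assoc C, ← mul_pow, ← pow_succ']
    gcongr
  · refine le_max_of_le_right ?_
    rw [max_eq_right hle]
    calc C * ((k : ℝ) * (ℓ : ℝ) ^ d) ≤ C * (κ * Real.log x * (ℓ : ℝ) ^ d) := by gcongr
      _ = _ := by ring

/-- For shells of inverse polynomial width the logarithm in the bounds is of order `log n`. -/
theorem exists_log_le_mul_log {K : ℝ} (hK : 1 ≤ K) (p : ℝ) :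
    ∃ C : ℝ, 0 < C ∧ ∀ (n : ℕ) (Δ : ℝ), 2 ≤ n → 0 < Δ → (n : ℝ) ^ (-p) ≤ K * Δ →
      Real.log (√(n : ℝ) / Δ) ≤ C * Real.log n := by
  have hlog2 : 0 < Real.log 2 := Real.log_pos (by norm_num)
  have hlogK : 0 ≤ Real.log K := Real.log_nonneg hK
  -- The summands account for `√n`, for `log K` (using `n ≥ 2`), and for `n ^ (-p)`.
  refine ⟨1 / 2 + Real.log K / Real.log 2 + |p|, by positivity, fun n Δ hn hΔ h => ?_⟩
  have hn0 : (0 : ℝ) < n := by exact_mod_cast (by omega : 0 < n)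
  have hn2 : Real.log 2 ≤ Real.log n := Real.log_le_log (by norm_num) (by exact_mod_cast hn)
  have h1 := Real.log_le_log (Real.rpow_pos_of_pos hn0 _) h
  rw [Real.log_rpow hn0, Real.log_mul (by linarith) hΔ.ne'] at h1
  rw [Real.log_div (Real.sqrt_pos.2 hn0).ne' hΔ.ne', Real.log_sqrt hn0.le]
  have h2 : Real.log K ≤ Real.log K / Real.log 2 * Real.log n := by
    rw [div_mul_eq_mul_div, le_div_iff₀ hlog2]
    gcongr
  have h3 : p * Real.log n ≤ |p| * Real.log n := by
    have : 0 ≤ Real.log n := hlog2.le.trans hn2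
    gcongr
    exact le_abs_self p
  linarith

end

theorem mainTheorem4 (d r ℓ₀ : ℕ) (ξ : ℝ) (hξ : 0 < ξ) (K : ℝ) (hK : 1 ≤ K) :
    (∃ c₁ c₂ : ℝ, 0 < c₁ ∧ 0 < c₂ ∧
      ∀ (ℓ : ℕ) (V : Finset (Fin d → ℤ)) (h w : V → SpinOp V)
        (ψ : OrthonormalBasis (Fin (2 ^ V.card)) ℂ (SpinSpace V)) (en : Fin (2 ^ V.card) → ℝ)
        (β E Δ : ℝ),
        IsShellOfClusteringSystem r ℓ₀ ℓ ξ h w ψ en β E Δ →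
        AdmissibleWidth K V.card β Δ →
        shellVar ψ en E Δ ((V.card : ℂ)⁻¹ • ∑ i, w i)
          ≤ 1 / (V.card : ℝ) *
            max (c₁ * boundOne d V.card Δ ^ 2) (c₂ * boundTwo d V.card ℓ Δ ^ 2)) ∧
    (∀ (ℓ : ℕ) (p : ℝ), ∃ C : ℝ, 0 < C ∧
      ∀ (V : Finset (Fin d → ℤ)) (h w : V → SpinOp V)
        (ψ : OrthonormalBasis (Fin (2 ^ V.card)) ℂ (SpinSpace V)) (en : Fin (2 ^ V.card) → ℝ)
        (β E Δ : ℝ),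
        2 ≤ V.card →
        IsShellOfClusteringSystem r ℓ₀ ℓ ξ h w ψ en β E Δ →
        AdmissibleWidth K V.card β Δ →
        (V.card : ℝ) ^ (-p) ≤ K * Δ →
        shellVar ψ en E Δ ((V.card : ℂ)⁻¹ • ∑ i, w i)
          ≤ C * Real.log (V.card : ℝ) ^ (d + 1) / (V.card : ℝ)) := by
  refine ⟨exists_shellVar_le_max d r ℓ₀ hξ hK, fun ℓ p => ?_⟩
  obtain ⟨c₁, c₂, hc₁, hc₂, hmain⟩ := exists_shellVar_le_max d r ℓ₀ hξ hK
  obtain ⟨C, hC, hlog⟩ := exists_log_le_mul_log hK p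
  have hlog2 : 0 < Real.log 2 := Real.log_pos (by norm_num)
  -- The second entry of the maximum is linear in `log n`; `(log n / log 2) ^ d ≥ 1` raises it to
  -- the power `d + 1`.
  refine ⟨c₁ * C ^ (d + 1) + c₂ * (ℓ : ℝ) ^ d * C / Real.log 2 ^ d, by positivity, ?_⟩
  intro V h w ψ en β E Δ hV hsys hwidth hΔ
  refine (hmain ℓ V h w ψ en β E Δ hsys hwidth).trans ?_
  set n : ℝ := (V.card : ℝ) with hn
  have hL := hlog V.card Δ hV hsys.width_pos hΔ
  have hL0 : 0 ≤ Real.log (√n / Δ) := by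
    refine Real.log_nonneg ((?_ : (1 : ℝ) ≤ 1 + 1 / K).trans hwidth.1)
    have : 0 < 1 / K := by positivity
    linarith
  have hn2 : Real.log 2 ≤ Real.log n :=
    Real.log_le_log (by norm_num) (by rw [hn]; exact_mod_cast hV)
  have hn0 : 0 < Real.log n := hlog2.trans_le hn2
  rw [boundOne_sq hL0, boundTwo_sq hL0, ← hn, one_div_mul_eq_div]
  refine div_le_div_of_nonneg_right ?_ (by positivity)
  rw [add_mul]
  have e1 : c₁ * Real.log (√n / Δ) ^ (d + 1) ≤ c₁ * C ^ (d + 1) * Real.log n ^ (d + 1) := by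
    rw [mul_assoc, ← mul_pow]
    gcongr
  have e2 : c₂ * ((ℓ : ℝ) ^ d * Real.log (√n / Δ)) ≤
      c₂ * (ℓ : ℝ) ^ d * C / Real.log 2 ^ d * Real.log n ^ (d + 1) := by
    rw [div_mul_eq_mul_div, le_div_iff₀ (by positivity)]
    calc c₂ * ((ℓ : ℝ) ^ d * Real.log (√n / Δ)) * Real.log 2 ^ d
        ≤ c₂ * ((ℓ : ℝ) ^ d * (C * Real.log n)) * Real.log n ^ d := by gcongr
      _ = _ := by ring
  refine max_le (e1.trans (le_add_of_nonneg_right ?_)) (e2.trans (le_add_of_nonneg_left ?_)) <;>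
    positivity
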